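/- Let $n\ge 2$ and $0\le d\le n$, and let $\widetilde G^n_d$ be the oriented Grassmannian of oriented $d$-dimensional linear subspaces of $\mathbb R^n$, regarded as classes of ordered linearly independent $d$-frames $(u_1,\dots,u_d)$ modulo changes of basis of positive determinant. An (oriented) $d$-varifold is a nonnegative finite Radon measure on $\mathbb R^n\times\widetilde G^n_d$; the weight $|\mu|$ of a varifold $\mu$ is its marginal on $\mathbb R^n$. Let $V$ be a Hilbert space of vector fields $\mathbb R^n\to\mathbb R^n$ continuously embedded in $C^2_0(\mathbb R^n,\mathbb R^n)$, the space of $C^2$ fields that vanish at infinity together with their derivatives of order one and two. For $v\in L^2([0,1],V)$ let $\varphi^v$ be its flow, $\varphi^v_t(x)=x+\int_0^t v_s(\varphi^v_s(x))\,ds$ for $t\in[0,1]$, $x\in\mathbb R^n$. Let $k$ be a positive definite kernel on $\mathbb R^n\times\widetilde G^n_d$ and let $W$ be its reproducing kernel Hilbert space. Suppose that $k$ is $C_0$-universal (that is, $W$ is contained and dense in $C_0(\mathbb R^n\times\widetilde G^n_d)$ for the sup-norm), and that $W$ is continuously embedded in $C_0^1(\mathbb R^n\times\widetilde G^n_d)$,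 the space of $C^1$ functions that vanish at infinity together with their differential. For a linear form $T$ on $W$ let $\|T\|_{W^*}=\sup\{(T|\omega):\omega\in W,\ \|\omega\|_W\le 1\}$. Let $\mu,\mu'$ be $d$-varifolds such that $\operatorname{supp}(\mu)\subset K$ for some compact $K\subset\mathbb R^n\times\widetilde G^n_d$, and let $\gamma,\lambda>0$. For $v\in L^2([0,1],V)$ and a real-valued $\alpha\in L^2(|\mu|)$ put $$E(v,\alpha)=\frac12\int_0^1\|v_t\|_V^2\,dt+\frac\gamma2\int_{\mathbb R^n}(\alpha(x)-1)^2\,d|\mu|(x)+\frac\lambda2\big\|(\varphi^v_1)_\#(\alpha\mu)-\mu'\big\|_{W^*}^2,$$ where $$\big((\varphi)_\#(\alpha\mu)\,\big|\,\omega\big)=\int \alpha(x)\,\omega\big(\varphi(x),d_x\varphi\cdot U\big)\,J_U\varphi(x)\,d\mu(x,U),\qquad (\mu'|\omega)=\int\omega\,d\mu',$$ $d_x\varphi\cdot U$ is the oriented subspace spanned by the image under $d_x\varphi$ of a frame of $U$, and $J_U\varphi(x)=\sqrt{\det(d_x\varphi(u_i)\cdot d_x\varphi(u_j))_{i,j}}$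 for any orthonormal frame $(u_i)$ of $U$. Then every $v\in L^2([0,1],V)$ has a unique flow on $[0,1]$, and there exists $(v,\alpha)\in L^2([0,1],V)\times L^2(|\mu|)$ at which $E$ attains its infimum over $L^2([0,1],V)\times L^2(|\mu|)$. Likewise, the infimum of $E$ over the pairs $(v,\alpha)$ with $\alpha\ge 0$ $|\mu|$-almost everywhere is attained by such a pair. -/

import Mathlib

open MeasureTheory Set Filter Topology
open scoped ZeroAtInfty

noncomputable section

namespace VarifoldMetamorphosis

/-- The ambient Euclidean space `ℝⁿ`. -/
abbrev Euc (n : ℕ) : Type := EuclideanSpace ℝ (Fin n)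

/-! ### The oriented Grassmannian -/

/-- Ordered frames: linearly independent `d`-tuples of vectors of `ℝⁿ`. -/
abbrev Frame (n d : ℕ) : Type := {u : Fin d → Euc n // LinearIndependent ℝ u}

/-- Two frames span the same oriented subspace iff the change of basis between them has positive
determinant. -/
def SameOrientedSpan {n d : ℕ} (u w : Frame n d) : Prop :=
  ∃ A : Matrix (Fin d) (Fin d) ℝ, 0 < A.det ∧ ∀ i, w.1 i = ∑ j, A i j • u.1 j

theorem sum_smul_comp {n d : ℕ} (A B : Matrix (Fin d) (Fin d) ℝ) (u : Fin d → Euc n) (i : Fin d) :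
    ∑ j, B i j • ∑ k, A j k • u k = ∑ k, (B * A) i k • u k := by
  simp only [Finset.smul_sum, smul_smul, Matrix.mul_apply, Finset.sum_smul]
  exact Finset.sum_comm

instance frameSetoid (n d : ℕ) : Setoid (Frame n d) where
  r := SameOrientedSpan
  iseqv :=
    { refl := fun u => ⟨1, by simp, fun i => by simp [Matrix.one_apply]⟩
      symm := by
        rintro u w ⟨A, hA, h⟩
        refine ⟨A⁻¹, ?_, fun i => ?_⟩
        · rw [Matrix.det_nonsing_inv, Ring.inverse_eq_inv']
          positivity
        · simp only [h]
          rw [sum_smul_comp, Matrix.nonsing_inv_mul _ (isUnit_iff_ne_zero.mpr hA.ne')]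
          simp [Matrix.one_apply]
      trans := by
        rintro u w z ⟨A, hA, h⟩ ⟨B, hB, h'⟩
        refine ⟨B * A, ?_, fun i => ?_⟩
        · rw [Matrix.det_mul]
          positivity
        · rw [h' i]
          simp only [h]
          rw [sum_smul_comp] }

/-- The oriented Grassmannian of oriented `d`-dimensional linear subspaces of `ℝⁿ`, as classes of
frames, with the quotient topology. -/
def OrientedGrassmannian (n d : ℕ) : Type := Quotient (frameSetoid n d)

instance (n d : ℕ) : TopologicalSpace (OrientedGrassmannian n d) :=
  inferInstanceAs (TopologicalSpace (Quotient (frameSetoid n d)))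

instance (n d : ℕ) : MeasurableSpace (OrientedGrassmannian n d) :=
  borel (OrientedGrassmannian n d)

instance (n d : ℕ) : BorelSpace (OrientedGrassmannian n d) := ⟨rfl⟩

/-- The oriented subspace spanned by a frame. -/
def orientedSpan {n d : ℕ} (u : Frame n d) : OrientedGrassmannian n d :=
  Quotient.mk (frameSetoid n d) u

/-- The image of a frame under an injective linear map. -/
def Frame.map {n d : ℕ} (L : Euc n →L[ℝ] Euc n) (hL : Function.Injective L) (u : Frame n d) :
    Frame n d :=
  ⟨fun i => L (u.1 i), u.2.map' L.toLinearMap (LinearMap.ker_eq_bot.mpr hL)⟩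

open Classical in
/-- The transported oriented subspace `L · U`, for an injective linear map `L` (in particular for
the differential of a diffeomorphism); for other `L` it is not meaningful and set to `U`. -/
def OrientedGrassmannian.map {n d : ℕ} (L : Euc n →L[ℝ] Euc n) (U : OrientedGrassmannian n d) :
    OrientedGrassmannian n d :=
  if hL : Function.Injective L then
    Quotient.map (Frame.map L hL)
      (by
        rintro u w ⟨A, hA, h⟩
        exact ⟨A, hA, fun i => by simp [Frame.map, h i]⟩) U
  else U

theorem OrientedGrassmannian.map_orientedSpan {n d : ℕ} (L : Euc n →L[ℝ] Euc n)
    (hL : Function.Injective L) (u : Frame n d) :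
    (orientedSpan u).map L = orientedSpan (u.map L hL) :=
  dif_pos hL

theorem det_gram_change {n d : ℕ} (A : Matrix (Fin d) (Fin d) ℝ) (u w : Fin d → Euc n)
    (h : ∀ i, w i = ∑ j, A i j • u j) :
    (Matrix.gram ℝ w).det = A.det ^ 2 * (Matrix.gram ℝ u).det := by
  have : Matrix.gram ℝ w = A * Matrix.gram ℝ u * A.transpose := by
    ext i j
    simp only [Matrix.gram_apply, h, Matrix.mul_apply, Matrix.transpose_apply, sum_inner, inner_sum,
      real_inner_smul_left, real_inner_smul_right, Finset.sum_mul]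
    exact Finset.sum_congr rfl fun a _ => Finset.sum_congr rfl fun b _ => by ring
  rw [this, Matrix.det_mul, Matrix.det_mul, Matrix.det_transpose]
  ring

/-- The Jacobian of the linear map `L` along the oriented subspace `U`: the factor
`√(det (L uᵢ · L uⱼ)) / √(det (uᵢ · uⱼ))` by which `L` changes `d`-volume, for any frame `u` of `U`
(the denominator is `1` when `u` is orthonormal). -/
def jacobianAlong {n d : ℕ} (L : Euc n →L[ℝ] Euc n) (U : OrientedGrassmannian n d) : ℝ :=
  Quotient.lift
    (fun u : Frame n d =>
      √(Matrix.gram ℝ (fun i => L (u.1 i))).det / √(Matrix.gram ℝ u.1).det)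
    (by
      rintro u w ⟨A, hA, h⟩
      have h2 : ∀ i, L (w.1 i) = ∑ j, A i j • L (u.1 j) := fun i => by simp [h i]
      have e1 := det_gram_change A u.1 w.1 h
      have e2 := det_gram_change A (fun i => L (u.1 i)) (fun i => L (w.1 i)) h2
      simp only [e1, e2]
      rw [Real.sqrt_mul (by positivity), Real.sqrt_mul (by positivity), Real.sqrt_sq hA.le,
        mul_div_mul_left _ _ hA.ne']) U

theorem jacobianAlong_of_orthonormal {n d : ℕ} (L : Euc n →L[ℝ] Euc n) (u : Frame n d)
    (hu : Orthonormal ℝ u.1) :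
    jacobianAlong L (orientedSpan u) =
      √(Matrix.of fun i j => inner ℝ (L (u.1 i)) (L (u.1 j))).det := by
  have : Matrix.gram ℝ u.1 = 1 := by
    ext i j
    rw [Matrix.gram_apply, orthonormal_iff_ite.mp hu i j, Matrix.one_apply]
  change √(Matrix.gram ℝ (fun i => L (u.1 i))).det / √(Matrix.gram ℝ u.1).det = _
  rw [this]
  simp [Matrix.gram]

/-! ### Function spaces -/

open Classical in
/-- The lift of a function on `ℝⁿ × G̃ⁿ_d` to pairs (point, frame); it is only meaningful on the open
set of pairs whose second component is linearly independent. -/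
def frameLift {n d : ℕ} (ω : Euc n × OrientedGrassmannian n d → ℝ) :
    Euc n × (Fin d → Euc n) → ℝ :=
  fun p => if h : LinearIndependent ℝ p.2 then ω (p.1, orientedSpan ⟨p.2, h⟩) else 0

/-- `ω ∈ C₀¹(ℝⁿ × G̃ⁿ_d)`: a `C¹` function vanishing at infinity together with its differential.
The frame space is open in `(ℝⁿ)ᵈ` and projects onto the Grassmannian by a surjective submersion, so
`ω` is `C¹` on the manifold iff its lift is `C¹`; at an orthonormal frame `u` of `U` the norm of the
differential of the lift is, up to constants, the norm of the differential of `ω` at `(x, U)` for the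
canonical metric. As the Grassmannian is compact, going to infinity means `‖x‖ → ∞`. -/
structure IsC01 {n d : ℕ} (ω : Euc n × OrientedGrassmannian n d → ℝ) : Prop where
  zero_at_infty : ∃ f : C₀(Euc n × OrientedGrassmannian n d, ℝ), ⇑f = ω
  contDiffOn : ContDiffOn ℝ 1 (frameLift ω) {p | LinearIndependent ℝ p.2}
  fderiv_zero_at_infty : ∀ ε > 0, ∃ R : ℝ, ∀ (x : Euc n) (u : Fin d → Euc n),
    Orthonormal ℝ u → R ≤ ‖x‖ → ‖fderiv ℝ (frameLift ω) (x, u)‖ ≤ ε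

/-- The Hilbert space `W` of functions is continuously embedded in `C₀¹(ℝⁿ × G̃ⁿ_d)`. -/
def EmbedsInC01 (n d : ℕ) (W : Type*) [NormedAddCommGroup W] [InnerProductSpace ℝ W]
    [RKHS ℝ W (Euc n × OrientedGrassmannian n d) ℝ] : Prop :=
  ∃ c : ℝ, ∀ ω : W, IsC01 (⇑ω) ∧ (∀ p, |ω p| ≤ c * ‖ω‖) ∧
    ∀ (x : Euc n) (u : Fin d → Euc n), Orthonormal ℝ u →
      ‖fderiv ℝ (frameLift ⇑ω) (x, u)‖ ≤ c * ‖ω‖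

/-- The Hilbert space `V` of vector fields is continuously embedded in `C₀²(ℝⁿ, ℝⁿ)`, the `C²` vector
fields vanishing at infinity together with their derivatives of order one and two. -/
def EmbedsInC02 (n : ℕ) (V : Type*) [NormedAddCommGroup V] [InnerProductSpace ℝ V]
    [RKHS ℝ V (Euc n) (Euc n)] : Prop :=
  ∃ c : ℝ, ∀ u : V, ContDiff ℝ 2 (⇑u) ∧ ∀ i ≤ 2,
    Tendsto (iteratedFDeriv ℝ i ⇑u) (cocompact (Euc n)) (𝓝 0) ∧
    ∀ x, ‖iteratedFDeriv ℝ i (⇑u) x‖ ≤ c * ‖u‖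

/-- `k` is the reproducing kernel of the Hilbert space `W` of real functions on `X`, that is, `W` is
the RKHS of `k`. -/
def IsReproducingKernel {X : Type*} (k : X → X → ℝ) (W : Type*) [NormedAddCommGroup W]
    [InnerProductSpace ℝ W] [RKHS ℝ W X ℝ] : Prop :=
  ∀ q : X, ∃ kq : W, (∀ p, kq p = k p q) ∧ ∀ f : W, inner ℝ f kq = f q

/-- The kernel `k` with RKHS `W` is `C₀`-universal: `W` consists of functions of `C₀(X)` and is dense
in `C₀(X)` for the sup-norm. -/
def IsC0Universal {X : Type*} [TopologicalSpace X] (k : X → X → ℝ) (W : Type*)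
    [NormedAddCommGroup W] [InnerProductSpace ℝ W] [RKHS ℝ W X ℝ] : Prop :=
  IsReproducingKernel k W ∧ (∀ ω : W, ∃ f : C₀(X, ℝ), ⇑f = ⇑ω) ∧
    Dense {f : C₀(X, ℝ) | ∃ ω : W, ⇑ω = ⇑f}

/-! ### Time-dependent vector fields and their flows -/

/-- `L²([0,1], V)`. -/
abbrev TimeL2 (V : Type*) [NormedAddCommGroup V] : Type _ :=
  Lp V 2 (volume.restrict (Icc (0 : ℝ) 1))

/-- `φ` is the flow of `v`: `φ_t(x) = x + ∫₀ᵗ v_s(φ_s(x)) ds` for all `t ∈ [0,1]`, `x ∈ ℝⁿ`. -/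
def IsFlow {n : ℕ} {V : Type*} [NormedAddCommGroup V] [InnerProductSpace ℝ V]
    [RKHS ℝ V (Euc n) (Euc n)] (v : TimeL2 V) (φ : ℝ → Euc n → Euc n) : Prop :=
  ∀ x, ContinuousOn (fun t => φ t x) (Icc 0 1) ∧
    ∀ t ∈ Icc (0 : ℝ) 1, φ t x = x + ∫ s in (0 : ℝ)..t, (v s) (φ s x)

open Classical in
/-- The flow `φ^v` of `v`. -/
def flow {n : ℕ} {V : Type*} [NormedAddCommGroup V] [InnerProductSpace ℝ V]
    [RKHS ℝ V (Euc n) (Euc n)] (v : TimeL2 V) : ℝ → Euc n → Euc n :=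
  if h : ∃ φ, IsFlow v φ then h.choose else fun _ x => x

/-! ### Varifolds as distributions, their transformation and the energy -/

/-- A (signed) varifold seen as a distribution, through its pairing with test functions on
`ℝⁿ × G̃ⁿ_d`. -/
abbrev Distr (n d : ℕ) : Type := (Euc n × OrientedGrassmannian n d → ℝ) → ℝ

/-- `(μ | ω) = ∫ ω dμ`. -/
def toDistr {n d : ℕ} (μ : Measure (Euc n × OrientedGrassmannian n d)) : Distr n d :=
  fun ω => ∫ p, ω p ∂μ

/-- `(α μ | ω) = ∫ α(x) ω(x, U) dμ(x, U)`. -/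
def rescale {n d : ℕ} (α : Euc n → ℝ) (μ : Measure (Euc n × OrientedGrassmannian n d)) :
    Distr n d :=
  fun ω => ∫ p, α p.1 * ω p ∂μ

/-- `(φ_# T | ω) = (T | (x, U) ↦ ω(φ(x), d_xφ · U) J_U φ(x))`. -/
def pushforward {n d : ℕ} (φ : Euc n → Euc n) (T : Distr n d) : Distr n d :=
  fun ω => T fun p => ω (φ p.1, p.2.map (fderiv ℝ φ p.1)) * jacobianAlong (fderiv ℝ φ p.1) p.2

/-- The dual norm `‖T‖_{W*} = sup {(T | ω) : ω ∈ W, ‖ω‖_W ≤ 1}`. -/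
def dualNorm {n d : ℕ} (W : Type*) [NormedAddCommGroup W] [InnerProductSpace ℝ W]
    [RKHS ℝ W (Euc n × OrientedGrassmannian n d) ℝ] (T : Distr n d) : ℝ :=
  sSup {r | ∃ ω : W, ‖ω‖ ≤ 1 ∧ r = T ⇑ω}

/-- The functional of the relaxed static `L²` problem,
`½ ∫₀¹ ‖v_t‖_V² dt + (γ/2) ∫ (α - 1)² d|μ| + (λ/2) ‖(φ₁^v)_# (α μ) - μ'‖_{W*}²`, for
`v ∈ L²([0,1], V)` and `α ∈ L²(|μ|)`; the weight measure `|μ|` is the first marginal of `μ`. -/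
def relaxedEnergy {n d : ℕ} {V : Type*} [NormedAddCommGroup V] [InnerProductSpace ℝ V]
    [RKHS ℝ V (Euc n) (Euc n)] (W : Type*) [NormedAddCommGroup W] [InnerProductSpace ℝ W]
    [RKHS ℝ W (Euc n × OrientedGrassmannian n d) ℝ]
    (γ lam : ℝ) (μ μ' : Measure (Euc n × OrientedGrassmannian n d))
    (q : TimeL2 V × Lp ℝ 2 μ.fst) : ℝ :=
  1 / 2 * ∫ t in Icc (0 : ℝ) 1, ‖q.1 t‖ ^ 2
    + γ / 2 * ∫ x, (q.2 x - 1) ^ 2 ∂μ.fst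
    + lam / 2 * dualNorm W (pushforward (flow q.1 1) (rescale q.2 μ) - toDistr μ') ^ 2

end VarifoldMetamorphosis

end

open VarifoldMetamorphosis

/-!
The minimizers are found by the direct method. The energy bounds `‖v‖` and `‖α‖`, so a minimizing
sequence has a subsequence along which `v` and `α` converge weakly. By Grönwall's lemma the flow of
a field which is `C¹` with Lipschitz derivative depends continuously on the weak limit of the
controls: the error made in replacing `vₙ` by its limit `v` along the trajectory of `v` is
`∫₀ᵗ (vₙ - v)(s, φ_s) ds`, which tends to zero by weak convergence alone. The differential of the
flow solves a system of the same type, hence converges as well, and with it the pulled back test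
functions, boundedly and pointwise. Each pairing `((φ₁)_# (α μ) | ω)` therefore converges, being a
weakly convergent factor times a strongly convergent one. All three terms of the energy are thus
weakly lower semicontinuous: the norms are, and the dual norm is a supremum of such pairings.
-/

namespace VarifoldMetamorphosis

/-! ### Grönwall's inequality in integral form -/

section Gronwall

variable {w k : ℝ → ℝ} {K a b : ℝ}

theorem hasDerivWithinAt_integral_Ici (hw : ContinuousOn w (Icc a b)) {t : ℝ} (ht : t ∈ Ico a b) :
    HasDerivWithinAt (fun t => ∫ s in a..t, w s) (w t) (Ici t) t := by
  have hcont : ContinuousOn w (Icc t b) := hw.mono (Icc_subset_Icc_left ht.1)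
  have hnhds : Icc t b ∈ 𝓝[>] t := mem_of_superset (Ioo_mem_nhdsGT ht.2) Ioo_subset_Icc_self
  refine intervalIntegral.integral_hasDerivWithinAt_right (t := Ioi t) ?_ ?_ ?_
  · exact (hw.mono (Icc_subset_Icc_right ht.2.le)).intervalIntegrable_of_Icc ht.1
  · exact ⟨Icc t b, hnhds, hcont.aestronglyMeasurable measurableSet_Icc⟩
  · exact (hcont t (left_mem_Icc.mpr ht.2.le)).mono_of_mem_nhdsWithin hnhds

theorem continuousOn_integral_Icc (hw : ContinuousOn w (Icc a b)) :
    ContinuousOn (fun t => ∫ s in a..t, w s) (Icc a b) := by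
  refine (intervalIntegral.continuousOn_primitive (μ := volume) hw.integrableOn_Icc).congr ?_
  exact fun t ht => intervalIntegral.integral_of_le ht.1

theorem gronwallBound_zero_mul_add (K κ x : ℝ) :
    gronwallBound 0 K (K * κ) x + κ = Real.exp (K * x) * κ := by
  rcases eq_or_ne K 0 with rfl | hK
  · simp [gronwallBound_K0]
  · simp only [gronwallBound_of_K_ne_0 hK]
    field_simp
    ring

theorem le_of_le_add_mul_integral (hK : 0 ≤ K) (hw : ContinuousOn w (Icc a b))
    (hk : ContinuousOn k (Icc a b)) (hk0 : ∀ t ∈ Icc a b, 0 ≤ k t)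
    (h : ∀ t ∈ Icc a b, w t ≤ k t + K * ∫ s in a..t, w s) {t : ℝ} (ht : t ∈ Icc a b) :
    w t ≤ k t + K * (Real.exp (K * (b - a)) * ∫ s in a..b, k s) := by
  have hint {t : ℝ} (ht : t ∈ Icc a b) : ∫ s in a..t, k s ≤ ∫ s in a..b, k s :=
    intervalIntegral.integral_mono_interval le_rfl ht.1 ht.2
      ((ae_restrict_mem measurableSet_Ioc).mono fun s hs => hk0 s (Ioc_subset_Icc_self hs))
      (hk.intervalIntegrable_of_Icc (ht.1.trans ht.2))
  have hκ : 0 ≤ ∫ s in a..b, k s := intervalIntegral.integral_nonneg (ht.1.trans ht.2) hk0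
  -- The differential form of Grönwall's inequality applies to `∫ w - ∫ k`, as `w` need not be
  -- differentiable.
  have hsub : (∫ s in a..t, w s) - ∫ s in a..t, k s ≤
      gronwallBound 0 K (K * ∫ s in a..b, k s) (t - a) := by
    refine le_gronwallBound_of_liminf_deriv_right_le (f' := fun t => w t - k t)
      ((continuousOn_integral_Icc hw).sub (continuousOn_integral_Icc hk))
      (fun s hs r hr => ?_) (by simp) (fun s hs => ?_) t ht
    · exact ((hasDerivWithinAt_integral_Ici hw hs).sub
        (hasDerivWithinAt_integral_Ici hk hs)).liminf_right_slope_le hr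
    · have hs' := Ico_subset_Icc_self hs
      simp only [Pi.sub_apply]
      linarith [h s hs', mul_le_mul_of_nonneg_left (hint hs') hK]
  have hexp : ∫ s in a..t, w s ≤ Real.exp (K * (b - a)) * ∫ s in a..b, k s :=
    calc ∫ s in a..t, w s
        ≤ gronwallBound 0 K (K * ∫ s in a..b, k s) (t - a) + ∫ s in a..b, k s := by
          linarith [hint ht]
      _ = Real.exp (K * (t - a)) * ∫ s in a..b, k s := gronwallBound_zero_mul_add ..
      _ ≤ Real.exp (K * (b - a)) * ∫ s in a..b, k s := by gcongr; exact ht.2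
  exact (h t ht).trans (by gcongr)

theorem nonpos_of_le_mul_integral_right (hK : 0 ≤ K) (hw : ContinuousOn w (Icc a b))
    (h : ∀ t ∈ Icc a b, w t ≤ K * ∫ s in t..b, w s) {t : ℝ} (ht : t ∈ Icc a b) : w t ≤ 0 := by
  have hmem {t : ℝ} (ht : t ∈ Icc a b) : a + b - t ∈ Icc a b :=
    ⟨by linarith [ht.2], by linarith [ht.1]⟩
  have hrev := le_of_le_add_mul_integral (w := fun t => w (a + b - t)) (k := 0) hK
    (hw.comp (by fun_prop) fun _ => hmem) continuousOn_const (fun _ _ => le_rfl)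
    (fun t ht => by simpa using h _ (hmem ht)) (hmem ht)
  simpa using hrev

end Gronwall

/-! ### Weak convergence -/

/-- Weak convergence of a sequence in a normed space. -/
def WeakTendsto {E : Type*} [NormedAddCommGroup E] [NormedSpace ℝ E] (x : ℕ → E) (y : E) : Prop :=
  ∀ ℓ : StrongDual ℝ E, Tendsto (fun n => ℓ (x n)) atTop (𝓝 (ℓ y))

section Weak

variable {E F : Type*} [NormedAddCommGroup E] [NormedSpace ℝ E] [NormedAddCommGroup F]
  [NormedSpace ℝ F] {x : ℕ → E} {y : E}

theorem WeakTendsto.comp_strictMono (h : WeakTendsto x y) {θ : ℕ → ℕ} (hθ : StrictMono θ) :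
    WeakTendsto (x ∘ θ) y :=
  fun ℓ => (h ℓ).comp hθ.tendsto_atTop

theorem weakTendsto_const (y : E) : WeakTendsto (fun _ => y) y :=
  fun _ => tendsto_const_nhds

theorem WeakTendsto.sub_const (h : WeakTendsto x y) (z : E) :
    WeakTendsto (fun n => x n - z) (y - z) :=
  fun ℓ => by simpa only [map_sub] using (h ℓ).sub_const (ℓ z)

theorem WeakTendsto.map (h : WeakTendsto x y) (T : E →L[ℝ] F) :
    WeakTendsto (fun n => T (x n)) (T y) :=
  fun ℓ => h (ℓ ∘L T)

theorem WeakTendsto.tendsto [FiniteDimensional ℝ E] (h : WeakTendsto x y) :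
    Tendsto x atTop (𝓝 y) := by
  let e := (Module.finBasis ℝ E).equivFunL
  have hcoord : Tendsto (fun n => e (x n)) atTop (𝓝 (e y)) :=
    tendsto_pi_nhds.mpr fun i =>
      h (ContinuousLinearMap.proj (R := ℝ) (φ := fun _ => ℝ) i ∘L e.toContinuousLinearMap)
  simpa [Function.comp_def] using (e.symm.continuous.tendsto _).comp hcoord

theorem WeakTendsto.exists_norm_le (h : WeakTendsto x y) : ∃ M, ∀ n, ‖x n‖ ≤ M := by
  obtain ⟨M, hM⟩ := banach_steinhaus (g := fun n => NormedSpace.inclusionInDoubleDualLi ℝ (x n))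
    fun ℓ => (h ℓ).norm.bddAbove_range.imp fun C hC n => hC (mem_range_self n)
  exact ⟨M, fun n => ((NormedSpace.inclusionInDoubleDualLi ℝ).norm_map (x n)).symm.trans_le (hM n)⟩

theorem WeakTendsto.tendsto_clm_apply [FiniteDimensional ℝ F] (h : WeakTendsto x y)
    {T : ℕ → E →L[ℝ] F} {S : E →L[ℝ] F} (hT : Tendsto T atTop (𝓝 S)) :
    Tendsto (fun n => T n (x n)) atTop (𝓝 (S y)) := by
  obtain ⟨M, hM⟩ := h.exists_norm_le
  have hdiff : Tendsto (fun n => (T n - S) (x n)) atTop (𝓝 0) := by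
    refine squeeze_zero_norm (fun n => (T n - S).le_opNorm_of_le (hM n)) ?_
    simpa using (tendsto_iff_norm_sub_tendsto_zero.mp hT).mul_const M
  simpa using hdiff.add (h.map S).tendsto

theorem WeakTendsto.eventually_lt_norm (h : WeakTendsto x y) {r : ℝ} (hr : r < ‖y‖) :
    ∀ᶠ n in atTop, r < ‖x n‖ := by
  obtain ⟨ℓ, hℓ, hy⟩ := exists_dual_vector'' ℝ y
  filter_upwards [(h ℓ).eventually_const_lt (hr.trans_eq hy.symm)] with n hn
  calc r < ℓ (x n) := hn
    _ ≤ ‖ℓ (x n)‖ := le_abs_self _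
    _ ≤ ‖x n‖ := by simpa using ℓ.le_of_opNorm_le hℓ (x n)

theorem WeakTendsto.mem_of_convex_of_isClosed (h : WeakTendsto x y) {s : Set E}
    (hs : Convex ℝ s) (hs' : IsClosed s) (hx : ∀ n, x n ∈ s) : y ∈ s := by
  by_contra hy
  obtain ⟨ℓ, u, hyu, hus⟩ := geometric_hahn_banach_point_closed hs hs' hy
  exact hyu.not_ge (ge_of_tendsto' (h ℓ) fun n => (hus _ (hx n)).le)

end Weak

theorem exists_weakTendsto_subseq {H : Type*} [NormedAddCommGroup H] [InnerProductSpace ℝ H]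
    [CompleteSpace H] {x : ℕ → H} {M : ℝ} (hx : ∀ n, ‖x n‖ ≤ M) :
    ∃ (y : H) (θ : ℕ → ℕ), StrictMono θ ∧ WeakTendsto (x ∘ θ) y := by
  -- Banach–Alaoglu is sequential only on the dual of a separable space, hence the restriction to
  -- the closed span of the sequence.
  let S : Submodule ℝ H := (Submodule.span ℝ (range x)).topologicalClosure
  have hxS (n : ℕ) : x n ∈ S :=
    Submodule.le_topologicalClosure _ (Submodule.subset_span (mem_range_self n))
  have : TopologicalSpace.SeparableSpace S :=
    (((countable_range x).isSeparable.span (R := ℝ)).closure).separableSpace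
  have : CompleteSpace S := (Submodule.isClosed_topologicalClosure _).completeSpace_coe
  let D := InnerProductSpace.toDual ℝ S
  obtain ⟨f, -, θ, hθ, hf⟩ := WeakDual.isSeqCompact_closedBall ℝ S (0 : StrongDual ℝ S) M
    (x := fun n => StrongDual.toWeakDual (D ⟨x n, hxS n⟩))
    fun n => by simpa [D] using hx n
  refine ⟨(D.symm (WeakDual.toStrongDual f) : S), θ, hθ, fun ℓ => ?_⟩
  let kl : S := D.symm (ℓ.comp S.subtypeL)
  have hkl (z : S) : D z kl = ℓ z := by
    rw [InnerProductSpace.toDual_apply_apply, real_inner_comm, InnerProductSpace.toDual_symm_apply]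
    rfl
  have hlim := ((WeakDual.eval_continuous (𝕜 := ℝ) kl).tendsto f).comp hf
  rw [← hkl, LinearIsometryEquiv.apply_symm_apply]
  exact hlim.congr fun n => hkl ⟨x (θ n), hxS (θ n)⟩

/-! ### Integrals against square integrable functions -/

section SquareIntegrable

variable {X : Type*} [MeasurableSpace X] {ν : Measure X}
  {E : Type*} [NormedAddCommGroup E] [NormedSpace ℝ E]
  {F : Type*} [NormedAddCommGroup F] [NormedSpace ℝ F]
  {Z : Type*} [NormedAddCommGroup Z] [NormedSpace ℝ Z]

theorem integral_norm_sq_eq {E : Type*} [NormedAddCommGroup E] (v : Lp E 2 ν) :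
    ∫ x, ‖v x‖ ^ 2 ∂ν = ‖v‖ ^ 2 := by
  have h := (Lp.memLp v).eLpNorm_eq_integral_rpow_norm two_ne_zero ENNReal.ofNat_ne_top
  have h0 : 0 ≤ ∫ x, ‖v x‖ ^ 2 ∂ν := integral_nonneg fun _ => sq_nonneg _
  rw [Lp.norm_def, h, ENNReal.toReal_ofReal (by positivity)]
  simp only [ENNReal.toReal_ofNat, Real.rpow_ofNat]
  rw [← Real.rpow_natCast, ← Real.rpow_mul h0]
  simp

theorem integrable_clm_apply {G : X → E →L[ℝ] Z} {v : X → E} (hG : MemLp G 2 ν)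
    (hv : MemLp v 2 ν) : Integrable (fun x => G x (v x)) ν := by
  refine (hG.norm.integrable_mul hv.norm).mono'
    (isBoundedBilinearMap_apply.continuous.comp_aestronglyMeasurable
      (hG.aestronglyMeasurable.prodMk hv.aestronglyMeasurable)) ?_
  exact Eventually.of_forall fun x => (G x).le_opNorm _

theorem norm_integral_clm_apply_sq_le {G : X → E →L[ℝ] Z} {v : X → E} (hG : MemLp G 2 ν)
    (hv : MemLp v 2 ν) :
    ‖∫ x, G x (v x) ∂ν‖ ^ 2 ≤ (∫ x, ‖G x‖ ^ 2 ∂ν) * ∫ x, ‖v x‖ ^ 2 ∂ν := by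
  have holder := integral_mul_norm_le_Lp_mul_Lq Real.HolderConjugate.two_two
    (f := fun x => ‖G x‖) (g := fun x => ‖v x‖) (by simpa using hG.norm) (by simpa using hv.norm)
  simp only [norm_norm, Real.rpow_ofNat, ← Real.sqrt_eq_rpow] at holder
  calc ‖∫ x, G x (v x) ∂ν‖ ^ 2 ≤ (∫ x, ‖G x‖ * ‖v x‖ ∂ν) ^ 2 := by
        gcongr
        exact norm_integral_le_of_norm_le (hG.norm.integrable_mul hv.norm)
          (Eventually.of_forall fun x => (G x).le_opNorm _)
    _ ≤ (√(∫ x, ‖G x‖ ^ 2 ∂ν) * √(∫ x, ‖v x‖ ^ 2 ∂ν)) ^ 2 := by gcongr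
    _ = (∫ x, ‖G x‖ ^ 2 ∂ν) * ∫ x, ‖v x‖ ^ 2 ∂ν := by
        rw [mul_pow, Real.sq_sqrt (integral_nonneg fun _ => sq_nonneg _),
          Real.sq_sqrt (integral_nonneg fun _ => sq_nonneg _)]

variable [IsFiniteMeasure ν] {G' : ℕ → X → E} {G : X → E} {C : ℝ}

theorem tendsto_toLp_two {E : Type*} [NormedAddCommGroup E] {G' : ℕ → X → E} {G : X → E}
    (hG' : ∀ n, MemLp (G' n) 2 ν) (hG : MemLp G 2 ν) (hC : ∀ n, ∀ᵐ x ∂ν, ‖G' n x‖ ≤ C)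
    (hlim : ∀ᵐ x ∂ν, Tendsto (fun n => G' n x) atTop (𝓝 (G x))) :
    Tendsto (fun n => (hG' n).toLp (G' n)) atTop (𝓝 (hG.toLp G)) := by
  have hnorm (n : ℕ) : ‖(hG' n).toLp (G' n) - hG.toLp G‖ ^ 2 = ∫ x, ‖G' n x - G x‖ ^ 2 ∂ν := by
    rw [← MemLp.toLp_sub, ← integral_norm_sq_eq]
    refine integral_congr_ae ?_
    filter_upwards [((hG' n).sub hG).coeFn_toLp] with x hx
    rw [hx, Pi.sub_apply]
  have hsq : Tendsto (fun n => ‖(hG' n).toLp (G' n) - hG.toLp G‖ ^ 2) atTop (𝓝 0) := by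
    simp only [hnorm]
    rw [← integral_zero X ℝ (μ := ν)]
    refine tendsto_integral_of_dominated_convergence (fun _ => (C + C) ^ 2)
      (fun n => ((hG' n).sub hG).aestronglyMeasurable.norm.pow 2) (integrable_const _)
      (fun n => ?_) ?_
    · filter_upwards [hC n, ae_all_iff.mpr hC, hlim] with x hx hx' hlimx
      rw [norm_pow, norm_norm]
      gcongr
      exact (norm_sub_le _ _).trans (add_le_add hx (le_of_tendsto' hlimx.norm hx'))
    · filter_upwards [hlim] with x hx
      simpa using (tendsto_iff_norm_sub_tendsto_zero.mp hx).pow 2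
  exact tendsto_iff_norm_sub_tendsto_zero.mpr (by simpa using hsq.sqrt)

theorem WeakTendsto.tendsto_integral_bilin [FiniteDimensional ℝ Z] (B : E →L[ℝ] F →L[ℝ] Z)
    {v' : ℕ → Lp F 2 ν} {v : Lp F 2 ν} (hv : WeakTendsto v' v)
    (hG' : ∀ n, AEStronglyMeasurable (G' n) ν) (hC : ∀ n, ∀ᵐ x ∂ν, ‖G' n x‖ ≤ C)
    (hlim : ∀ᵐ x ∂ν, Tendsto (fun n => G' n x) atTop (𝓝 (G x))) :
    Tendsto (fun n => ∫ x, B (G' n x) (v' n x) ∂ν) atTop (𝓝 (∫ x, B (G x) (v x) ∂ν)) := by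
  have : CompleteSpace Z := FiniteDimensional.complete ℝ Z
  have hG'2 (n : ℕ) : MemLp (G' n) 2 ν := MemLp.of_bound (hG' n) C (hC n)
  have hG2 : MemLp G 2 ν := by
    refine MemLp.of_bound (aestronglyMeasurable_of_tendsto_ae atTop hG' hlim) C ?_
    filter_upwards [ae_all_iff.mpr hC, hlim] with x hx hlimx using le_of_tendsto' hlimx.norm hx
  have hpair {g : X → E} (hg : MemLp g 2 ν) (w : Lp F 2 ν) :
      B.lpPairing ν 2 2 (hg.toLp g) w = ∫ x, B (g x) (w x) ∂ν := by
    rw [ContinuousLinearMap.lpPairing_eq_integral]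
    refine integral_congr_ae ?_
    filter_upwards [hg.coeFn_toLp] with x hx
    rw [hx]
  simp only [← hpair (hG'2 _), ← hpair hG2]
  exact hv.tendsto_clm_apply
    (((B.lpPairing ν 2 2).continuous.tendsto _).comp (tendsto_toLp_two hG'2 hG2 hC hlim))

end SquareIntegrable

section UnitInterval

variable {E : Type*} [NormedAddCommGroup E]

theorem memLp_two_of_continuousOn {g : ℝ → E} (hg : ContinuousOn g (Icc 0 1)) :
    MemLp g 2 (volume.restrict (Icc (0 : ℝ) 1)) := by
  obtain ⟨C, hC⟩ := isCompact_Icc.exists_bound_of_continuousOn hg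
  exact MemLp.of_bound (hg.aestronglyMeasurable measurableSet_Icc) C
    ((ae_restrict_mem measurableSet_Icc).mono hC)

theorem restrict_Ioc_le {a b : ℝ} (ha : 0 ≤ a) (hb : b ≤ 1) :
    volume.restrict (Ioc a b) ≤ volume.restrict (Icc (0 : ℝ) 1) :=
  Measure.restrict_mono (Ioc_subset_Icc_self.trans (Icc_subset_Icc ha hb)) le_rfl

variable {V : Type*} [NormedAddCommGroup V] [NormedSpace ℝ V]
  {Z : Type*} [NormedAddCommGroup Z] [NormedSpace ℝ Z]
  {G : ℝ → V →L[ℝ] Z} {v : TimeL2 V}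

theorem integrableOn_clm_apply (hG : ContinuousOn G (Icc 0 1)) (v : TimeL2 V) :
    IntegrableOn (fun s => G s (v s)) (Icc (0 : ℝ) 1) :=
  integrable_clm_apply (memLp_two_of_continuousOn hG) (Lp.memLp v)

theorem intervalIntegrable_clm_apply (hG : ContinuousOn G (Icc 0 1)) (v : TimeL2 V) {a b : ℝ}
    (ha : 0 ≤ a) (hab : a ≤ b) (hb : b ≤ 1) :
    IntervalIntegrable (fun s => G s (v s)) volume a b :=
  (intervalIntegrable_iff_integrableOn_Ioc_of_le hab).mpr
    ((integrableOn_clm_apply hG v).mono_set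
      (Ioc_subset_Icc_self.trans (Icc_subset_Icc ha hb)))

theorem continuousOn_integral_clm_apply (hG : ContinuousOn G (Icc 0 1)) (v : TimeL2 V) :
    ContinuousOn (fun t => ∫ s in (0 : ℝ)..t, G s (v s)) (Icc 0 1) := by
  refine (intervalIntegral.continuousOn_primitive (integrableOn_clm_apply hG v)).congr ?_
  exact fun t ht => intervalIntegral.integral_of_le ht.1

theorem norm_intervalIntegral_clm_apply_sq_le (hG : ContinuousOn G (Icc 0 1)) (v : TimeL2 V)
    {a b : ℝ} (ha : 0 ≤ a) (hab : a ≤ b) (hb : b ≤ 1) :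
    ‖∫ s in a..b, G s (v s)‖ ^ 2 ≤ ‖v‖ ^ 2 * ∫ s in a..b, ‖G s‖ ^ 2 := by
  have hle := restrict_Ioc_le ha hb
  simp only [intervalIntegral.integral_of_le hab]
  calc _ ≤ (∫ s in Ioc a b, ‖G s‖ ^ 2) * ∫ s in Ioc a b, ‖v s‖ ^ 2 :=
        norm_integral_clm_apply_sq_le ((memLp_two_of_continuousOn hG).mono_measure hle)
          ((Lp.memLp v).mono_measure hle)
    _ ≤ (∫ s in Ioc a b, ‖G s‖ ^ 2) * ∫ s in Icc 0 1, ‖v s‖ ^ 2 :=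
        mul_le_mul_of_nonneg_left (integral_mono_measure hle
          (Eventually.of_forall fun _ => sq_nonneg _) (Lp.memLp v).norm.integrable_sq)
          (integral_nonneg fun _ => sq_nonneg _)
    _ = ‖v‖ ^ 2 * ∫ s in Ioc a b, ‖G s‖ ^ 2 := by rw [integral_norm_sq_eq, mul_comm]

theorem norm_intervalIntegral_clm_apply_le (hG : ContinuousOn G (Icc 0 1)) (v : TimeL2 V) {C : ℝ}
    (hC : ∀ s ∈ Icc (0 : ℝ) 1, ‖G s‖ ≤ C) {t : ℝ} (ht : t ∈ Icc (0 : ℝ) 1) :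
    ‖∫ s in (0 : ℝ)..t, G s (v s)‖ ≤ C * ‖v‖ := by
  have hC0 : 0 ≤ C := (norm_nonneg _).trans (hC t ht)
  refine le_of_sq_le_sq ?_ (by positivity)
  calc ‖∫ s in (0 : ℝ)..t, G s (v s)‖ ^ 2 ≤ ‖v‖ ^ 2 * ∫ s in (0 : ℝ)..t, ‖G s‖ ^ 2 :=
        norm_intervalIntegral_clm_apply_sq_le hG v le_rfl ht.1 ht.2
    _ ≤ ‖v‖ ^ 2 * ∫ s in (0 : ℝ)..t, C ^ 2 := by
        gcongr
        refine intervalIntegral.integral_mono_on ht.1 ?_ intervalIntegrable_const fun s hs => ?_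
        · exact ((hG.mono (Icc_subset_Icc_right ht.2)).norm.pow 2).intervalIntegrable_of_Icc ht.1
        · gcongr
          exact hC s ⟨hs.1, hs.2.trans ht.2⟩
    _ ≤ ‖v‖ ^ 2 * C ^ 2 := by
        rw [intervalIntegral.integral_const, sub_zero, smul_eq_mul]
        gcongr
        exact mul_le_of_le_one_left (sq_nonneg C) ht.2
    _ = (C * ‖v‖) ^ 2 := by ring

theorem WeakTendsto.tendsto_intervalIntegral_clm_apply [FiniteDimensional ℝ Z]
    {G' : ℕ → ℝ → V →L[ℝ] Z} {v' : ℕ → TimeL2 V} (hv : WeakTendsto v' v)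
    (hG' : ∀ n, ContinuousOn (G' n) (Icc 0 1)) {C : ℝ}
    (hC : ∀ n, ∀ s ∈ Icc (0 : ℝ) 1, ‖G' n s‖ ≤ C)
    (hlim : ∀ s ∈ Icc (0 : ℝ) 1, Tendsto (fun n => G' n s) atTop (𝓝 (G s))) {t : ℝ}
    (ht : t ∈ Icc (0 : ℝ) 1) :
    Tendsto (fun n => ∫ s in (0 : ℝ)..t, G' n s (v' n s)) atTop
      (𝓝 (∫ s in (0 : ℝ)..t, G s (v s))) := by
  have hrestrict (H : ℝ → V →L[ℝ] Z) (w : TimeL2 V) :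
      ∫ s in (0 : ℝ)..t, H s (w s) =
        ∫ s in Icc (0 : ℝ) 1, ContinuousLinearMap.id ℝ _ ((Ioc 0 t).indicator H s) (w s) := by
    have hind (s : ℝ) : ContinuousLinearMap.id ℝ _ ((Ioc 0 t).indicator H s) (w s) =
        (Ioc 0 t).indicator (fun s => H s (w s)) s := by
      by_cases hs : s ∈ Ioc 0 t <;> simp [hs]
    simp only [hind]
    rw [intervalIntegral.integral_of_le ht.1, setIntegral_indicator measurableSet_Ioc,
      inter_eq_right.mpr (Ioc_subset_Icc_self.trans (Icc_subset_Icc_right ht.2))]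
  simp only [hrestrict]
  refine hv.tendsto_integral_bilin (C := C) _
    (fun n => ((hG' n).aestronglyMeasurable measurableSet_Icc).indicator measurableSet_Ioc)
    (fun n => ?_) ?_
  · filter_upwards [ae_restrict_mem measurableSet_Icc] with s hs
    exact (norm_indicator_le_norm_self _ _).trans (hC n s hs)
  · filter_upwards [ae_restrict_mem measurableSet_Icc] with s hs
    by_cases hst : s ∈ Ioc 0 t
    · simpa only [indicator_of_mem hst] using hlim s hs
    · simp only [indicator_of_notMem hst, tendsto_const_nhds_iff]

end UnitInterval

/-! ### Differential equations driven by square integrable controls -/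

section Volterra

variable {Z : Type*} [MetricSpace Z] {K : ℝ} {T : C(Icc (0 : ℝ) 1, Z) → C(Icc (0 : ℝ) 1, Z)}

open Nat in
theorem dist_iterate_sq_le_of_dist_sq_le_integral (hK : 0 ≤ K)
    (hT : ∀ y w (t : Icc (0 : ℝ) 1), dist (T y t) (T w t) ^ 2 ≤
      K * ∫ s in (0 : ℝ)..t, dist (IccExtend zero_le_one y s) (IccExtend zero_le_one w s) ^ 2)
    (y w : C(Icc (0 : ℝ) 1, Z)) (k : ℕ) (t : Icc (0 : ℝ) 1) :
    dist (T^[k] y t) (T^[k] w t) ^ 2 ≤ K ^ k * ((t : ℝ) ^ k / k !) * dist y w ^ 2 := by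
  induction k generalizing t with
  | zero =>
    simp only [Function.iterate_zero, id_eq, pow_zero, factorial_zero, cast_one, div_one, one_mul]
    gcongr
    exact ContinuousMap.dist_apply_le_dist _
  | succ k ih =>
    rw [Function.iterate_succ_apply', Function.iterate_succ_apply']
    have hext (u : C(Icc (0 : ℝ) 1, Z)) : Continuous (IccExtend (zero_le_one' ℝ) u) :=
      u.continuous.Icc_extend'
    calc dist (T (T^[k] y) t) (T (T^[k] w) t) ^ 2
        ≤ K * ∫ s in (0 : ℝ)..t, dist (IccExtend zero_le_one (T^[k] y) s)
            (IccExtend zero_le_one (T^[k] w) s) ^ 2 := hT _ _ t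
      _ ≤ K * ∫ s in (0 : ℝ)..t, K ^ k * (s ^ k / k !) * dist y w ^ 2 := by
          gcongr
          refine intervalIntegral.integral_mono_on t.2.1
            (((hext _).dist (hext _)).pow 2).continuousOn.intervalIntegrable
            (Continuous.intervalIntegrable (by fun_prop) _ _) fun s hs => ?_
          have hs' : s ∈ Icc (0 : ℝ) 1 := ⟨hs.1, hs.2.trans t.2.2⟩
          simpa only [IccExtend_of_mem _ _ hs'] using ih ⟨s, hs'⟩
      _ = K ^ (k + 1) * ((t : ℝ) ^ (k + 1) / (k + 1)!) * dist y w ^ 2 := by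
          rw [intervalIntegral.integral_mul_const, intervalIntegral.integral_const_mul,
            intervalIntegral.integral_div, integral_pow, factorial_succ]
          push_cast
          field_simp
          ring

open Nat in
theorem exists_isFixedPt_of_dist_sq_le_integral [CompleteSpace Z] [Nonempty Z] (hK : 0 ≤ K)
    (hT : ∀ y w (t : Icc (0 : ℝ) 1), dist (T y t) (T w t) ^ 2 ≤
      K * ∫ s in (0 : ℝ)..t, dist (IccExtend zero_le_one y s) (IccExtend zero_le_one w s) ^ 2) :
    ∃ y, Function.IsFixedPt T y := by
  obtain ⟨k, hk⟩ := ((FloorSemiring.tendsto_pow_div_factorial_atTop K).eventually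
    (gt_mem_nhds (by norm_num : (0 : ℝ) < (1 / 2) ^ 2))).exists
  have : Nonempty C(Icc (0 : ℝ) 1, Z) := ‹Nonempty Z›.map (ContinuousMap.const _)
  have hcontr : ContractingWith (1 / 2) T^[k] := by
    refine ⟨by norm_num, LipschitzWith.of_dist_le_mul fun y w => ?_⟩
    refine (ContinuousMap.dist_le (by positivity)).mpr fun t => le_of_sq_le_sq ?_ (by positivity)
    calc dist (T^[k] y t) (T^[k] w t) ^ 2
        ≤ K ^ k * ((t : ℝ) ^ k / k !) * dist y w ^ 2 :=
          dist_iterate_sq_le_of_dist_sq_le_integral hK hT y w k t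
      _ ≤ K ^ k * (1 / k !) * dist y w ^ 2 := by
          gcongr
          exact pow_le_one₀ t.2.1 t.2.2
      _ ≤ (1 / 2) ^ 2 * dist y w ^ 2 := by
          gcongr
          simpa [div_eq_mul_inv] using hk.le
      _ = _ := by
          rw [mul_pow]
          norm_num
  exact ⟨ContractingWith.fixedPoint T^[k] hcontr, hcontr.isFixedPt_fixedPoint_iterate⟩

end Volterra

section ControlledODE

variable {V : Type*} [NormedAddCommGroup V] [NormedSpace ℝ V]
  {Z : Type*} [NormedAddCommGroup Z] [NormedSpace ℝ Z]

/-- A time-dependent field of operators on `[0, 1]`, continuous along continuous curves and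
uniformly Lipschitz in the state; it turns a control with values in `V` into a vector field
on `Z`. -/
structure IsLipschitzField (B : ℝ → Z → V →L[ℝ] Z) (c : NNReal) : Prop where
  continuousOn : ∀ z : ℝ → Z, ContinuousOn z (Icc 0 1) →
    ContinuousOn (fun s => B s (z s)) (Icc 0 1)
  lipschitzWith : ∀ s ∈ Icc (0 : ℝ) 1, LipschitzWith c (B s)

/-- `z` solves `ż = B(z) v`, `z₀ = x` on `[0, 1]`, in integral form since `v` is only square
integrable. -/
structure IsSolution (B : ℝ → Z → V →L[ℝ] Z) (v : TimeL2 V) (x : Z) (z : ℝ → Z) : Prop where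
  continuousOn : ContinuousOn z (Icc 0 1)
  eq_integral : ∀ t ∈ Icc (0 : ℝ) 1, z t = x + ∫ s in (0 : ℝ)..t, B s (z s) (v s)

/-- The defect of a curve `z` in the integral equation `z = x + ∫ B(z) v`. -/
noncomputable def residual (B : ℝ → Z → V →L[ℝ] Z) (v : TimeL2 V) (x : Z) (z : ℝ → Z) (t : ℝ) :
    Z :=
  z t - x - ∫ s in (0 : ℝ)..t, B s (z s) (v s)

/-- The constant by which the distance of an approximate to an exact solution is controlled by the
residual, as a function of the product of the Lipschitz constant and the norm of the control. -/
noncomputable def growth (a : ℝ) : ℝ := √(2 * (1 + 2 * a ^ 2 * Real.exp (2 * a ^ 2)))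

theorem growth_nonneg (a : ℝ) : 0 ≤ growth a := Real.sqrt_nonneg _

theorem growth_le_growth {a b : ℝ} (ha : 0 ≤ a) (hab : a ≤ b) : growth a ≤ growth b := by
  unfold growth
  gcongr

variable {B : ℝ → Z → V →L[ℝ] Z} {c : NNReal} {v : TimeL2 V} {x x' : Z} {y z : ℝ → Z}

theorem IsLipschitzField.norm_integral_sub_sq_le (hB : IsLipschitzField B c) (v : TimeL2 V)
    (hy : ContinuousOn y (Icc 0 1)) (hz : ContinuousOn z (Icc 0 1)) {a b : ℝ} (ha : 0 ≤ a)
    (hab : a ≤ b) (hb : b ≤ 1) :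
    ‖(∫ s in a..b, B s (z s) (v s)) - ∫ s in a..b, B s (y s) (v s)‖ ^ 2 ≤
      (c * ‖v‖) ^ 2 * ∫ s in a..b, ‖z s - y s‖ ^ 2 := by
  have hBy := hB.continuousOn y hy
  have hBz := hB.continuousOn z hz
  have hsub : Icc a b ⊆ Icc 0 1 := Icc_subset_Icc ha hb
  rw [← intervalIntegral.integral_sub (intervalIntegrable_clm_apply hBz v ha hab hb)
    (intervalIntegrable_clm_apply hBy v ha hab hb)]
  calc _ ≤ ‖v‖ ^ 2 * ∫ s in a..b, ‖B s (z s) - B s (y s)‖ ^ 2 :=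
        norm_intervalIntegral_clm_apply_sq_le (hBz.sub hBy) v ha hab hb
    _ ≤ ‖v‖ ^ 2 * ∫ s in a..b, (c * ‖z s - y s‖) ^ 2 := by
        gcongr
        refine intervalIntegral.integral_mono_on hab
          ((((hBz.sub hBy).mono hsub).norm.pow 2).intervalIntegrable_of_Icc hab)
          ((((((hz.sub hy).mono hsub).norm).const_mul (c : ℝ)).pow 2).intervalIntegrable_of_Icc hab)
          fun s hs => ?_
        gcongr
        exact (hB.lipschitzWith s (hsub hs)).norm_sub_le _ _
    _ = _ := by
        simp only [mul_pow, intervalIntegral.integral_const_mul]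
        ring

theorem IsLipschitzField.continuousOn_residual (hB : IsLipschitzField B c) (v : TimeL2 V) (x : Z)
    (hz : ContinuousOn z (Icc 0 1)) : ContinuousOn (residual B v x z) (Icc 0 1) :=
  (hz.sub continuousOn_const).sub (continuousOn_integral_clm_apply (hB.continuousOn z hz) v)

theorem IsSolution.residual_eq (h : IsSolution B v x' y) {t : ℝ} (ht : t ∈ Icc (0 : ℝ) 1) :
    residual B v x y t = x' - x := by
  rw [residual, h.eq_integral t ht]
  abel

theorem IsSolution.norm_sub_sq_le (hB : IsLipschitzField B c) (h : IsSolution B v x y)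
    (hz : ContinuousOn z (Icc 0 1)) {t : ℝ} (ht : t ∈ Icc (0 : ℝ) 1) :
    ‖z t - y t‖ ^ 2 ≤ 2 * ‖residual B v x z t‖ ^ 2 + 2 * (c * ‖v‖) ^ 2 *
      (Real.exp (2 * (c * ‖v‖) ^ 2) * ∫ s in (0 : ℝ)..1, 2 * ‖residual B v x z s‖ ^ 2) := by
  have hgron (t : ℝ) (ht : t ∈ Icc (0 : ℝ) 1) : ‖z t - y t‖ ^ 2 ≤
      2 * ‖residual B v x z t‖ ^ 2 + 2 * (c * ‖v‖) ^ 2 * ∫ s in (0 : ℝ)..t, ‖z s - y s‖ ^ 2 := by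
    have hsplit : z t - y t = residual B v x z t +
        ((∫ s in (0 : ℝ)..t, B s (z s) (v s)) - ∫ s in (0 : ℝ)..t, B s (y s) (v s)) := by
      rw [residual, h.eq_integral t ht]
      abel
    have hint := hB.norm_integral_sub_sq_le v h.continuousOn hz le_rfl ht.1 ht.2
    rw [hsplit]
    refine (pow_le_pow_left₀ (norm_nonneg _) (norm_add_le _ _) 2).trans ?_
    linarith [add_sq_le (a := ‖residual B v x z t‖) (b := ‖(∫ s in (0 : ℝ)..t, B s (z s) (v s)) -
      ∫ s in (0 : ℝ)..t, B s (y s) (v s)‖)]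
  have hres : ContinuousOn (fun t => 2 * ‖residual B v x z t‖ ^ 2) (Icc 0 1) :=
    ((hB.continuousOn_residual v x hz).norm.pow 2).const_mul 2
  simpa using le_of_le_add_mul_integral (by positivity) ((hz.sub h.continuousOn).norm.pow 2)
    hres (fun _ _ => by positivity) hgron ht

theorem IsSolution.norm_sub_le_of_residual_le (hB : IsLipschitzField B c)
    (h : IsSolution B v x y) (hz : ContinuousOn z (Icc 0 1)) {δ : ℝ}
    (hδ : ∀ t ∈ Icc (0 : ℝ) 1, ‖residual B v x z t‖ ≤ δ) {t : ℝ} (ht : t ∈ Icc (0 : ℝ) 1) :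
    ‖z t - y t‖ ≤ growth (c * ‖v‖) * δ := by
  have hδ0 : 0 ≤ δ := (norm_nonneg _).trans (hδ t ht)
  have hint : ∫ s in (0 : ℝ)..1, 2 * ‖residual B v x z s‖ ^ 2 ≤ ∫ s in (0 : ℝ)..1, 2 * δ ^ 2 := by
    refine intervalIntegral.integral_mono_on zero_le_one
      ((((hB.continuousOn_residual v x hz).norm.pow 2).const_mul 2).intervalIntegrable_of_Icc
        zero_le_one) intervalIntegrable_const fun s hs => ?_
    gcongr
    exact hδ s hs
  rw [intervalIntegral.integral_const, sub_zero, one_smul] at hint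
  refine le_of_sq_le_sq ?_ (mul_nonneg (growth_nonneg _) hδ0)
  calc ‖z t - y t‖ ^ 2 ≤ 2 * δ ^ 2 + 2 * (c * ‖v‖) ^ 2 *
        (Real.exp (2 * (c * ‖v‖) ^ 2) * (2 * δ ^ 2)) := by
        refine (h.norm_sub_sq_le hB hz ht).trans ?_
        gcongr
        exact hδ t ht
    _ = (growth (c * ‖v‖) * δ) ^ 2 := by
        rw [growth, mul_pow √_, Real.sq_sqrt (by positivity)]
        ring

theorem IsSolution.norm_sub_le (hB : IsLipschitzField B c) (h : IsSolution B v x y)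
    (h' : IsSolution B v x' z) {t : ℝ} (ht : t ∈ Icc (0 : ℝ) 1) :
    ‖z t - y t‖ ≤ growth (c * ‖v‖) * ‖x' - x‖ :=
  h.norm_sub_le_of_residual_le hB h'.continuousOn (fun _ ht => (h'.residual_eq ht).symm ▸ le_rfl) ht

theorem IsSolution.eqOn (hB : IsLipschitzField B c) (h : IsSolution B v x y)
    (h' : IsSolution B v x z) : EqOn y z (Icc 0 1) := by
  intro t ht
  have hle := h'.norm_sub_le hB h ht
  rw [sub_self, norm_zero, mul_zero, norm_le_zero_iff] at hle
  exact sub_eq_zero.mp hle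

theorem IsSolution.eqOn_of_eq_one (hB : IsLipschitzField B c) (h : IsSolution B v x y)
    (h' : IsSolution B v x' z) (h1 : y 1 = z 1) : EqOn y z (Icc 0 1) := by
  intro t ht
  have hle (t : ℝ) (ht : t ∈ Icc (0 : ℝ) 1) :
      ‖y t - z t‖ ^ 2 ≤ (c * ‖v‖) ^ 2 * ∫ s in t..1, ‖y s - z s‖ ^ 2 := by
    have hfrom_one {x : Z} {y : ℝ → Z} (h : IsSolution B v x y) :
        y t = y 1 - ∫ s in t..1, B s (y s) (v s) := by
      have hBy := hB.continuousOn y h.continuousOn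
      rw [h.eq_integral t ht, h.eq_integral 1 (right_mem_Icc.mpr zero_le_one),
        ← intervalIntegral.integral_add_adjacent_intervals
          (intervalIntegrable_clm_apply hBy v le_rfl ht.1 ht.2)
          (intervalIntegrable_clm_apply hBy v ht.1 ht.2 le_rfl)]
      abel
    rw [hfrom_one h, hfrom_one h', h1, sub_sub_sub_cancel_left, norm_sub_rev]
    exact hB.norm_integral_sub_sq_le v h'.continuousOn h.continuousOn ht.1 ht.2 le_rfl
  have hzero := nonpos_of_le_mul_integral_right (sq_nonneg _)
    ((h.continuousOn.sub h'.continuousOn).norm.pow 2) hle ht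
  rw [← sub_eq_zero, ← norm_eq_zero]
  exact pow_eq_zero_iff two_ne_zero |>.mp (hzero.antisymm (sq_nonneg _))

theorem IsLipschitzField.exists_isSolution [CompleteSpace Z] (hB : IsLipschitzField B c)
    (v : TimeL2 V) (x : Z) : ∃ y, IsSolution B v x y := by
  have hext (y : C(Icc (0 : ℝ) 1, Z)) :
      ContinuousOn (IccExtend (zero_le_one' ℝ) y) (Icc 0 1) :=
    y.continuous.Icc_extend'.continuousOn
  let T (y : C(Icc (0 : ℝ) 1, Z)) : C(Icc (0 : ℝ) 1, Z) :=
    ⟨fun t => x + ∫ s in (0 : ℝ)..t, B s (IccExtend zero_le_one y s) (v s), continuous_const.add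
      (continuousOn_integral_clm_apply (hB.continuousOn _ (hext y)) v).domRestrict⟩
  obtain ⟨y, hy⟩ := exists_isFixedPt_of_dist_sq_le_integral (T := T) (sq_nonneg (c * ‖v‖))
    fun y w t => by
      simpa only [T, ContinuousMap.coe_mk, dist_eq_norm, add_sub_add_left_eq_sub] using
        hB.norm_integral_sub_sq_le v (hext w) (hext y) le_rfl t.2.1 t.2.2
  refine ⟨IccExtend zero_le_one y, hext y, fun t ht => ?_⟩
  rw [IccExtend_of_mem _ _ ht]
  exact (DFunLike.congr_fun hy ⟨t, ht⟩).symm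

section Convergence

variable {B' : ℕ → ℝ → Z → V →L[ℝ] Z} {v' : ℕ → TimeL2 V} {x' : ℕ → Z} {D : ℝ}

theorem IsSolution.tendsto_residual [FiniteDimensional ℝ Z]
    (hB' : ∀ n, IsLipschitzField (B' n) c) (h : IsSolution B v x y)
    (hx : Tendsto x' atTop (𝓝 x)) (hv : WeakTendsto v' v)
    (hD : ∀ n, ∀ s ∈ Icc (0 : ℝ) 1, ‖B' n s (y s)‖ ≤ D)
    (hlim : ∀ s ∈ Icc (0 : ℝ) 1, Tendsto (fun n => B' n s (y s)) atTop (𝓝 (B s (y s))))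
    {t : ℝ} (ht : t ∈ Icc (0 : ℝ) 1) :
    Tendsto (fun n => residual (B' n) (v' n) (x' n) y t) atTop (𝓝 0) := by
  rw [← sub_self x, ← h.residual_eq ht]
  exact (hx.const_sub (y t)).sub (hv.tendsto_intervalIntegral_clm_apply
    (fun n => (hB' n).continuousOn y h.continuousOn) hD hlim ht)

theorem exists_norm_residual_le (hB' : ∀ n, IsLipschitzField (B' n) c)
    (hy : ContinuousOn y (Icc 0 1)) (hx : Tendsto x' atTop (𝓝 x)) (hv : WeakTendsto v' v)
    (hD : ∀ n, ∀ s ∈ Icc (0 : ℝ) 1, ‖B' n s (y s)‖ ≤ D) :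
    ∃ R, ∀ n, ∀ t ∈ Icc (0 : ℝ) 1, ‖residual (B' n) (v' n) (x' n) y t‖ ≤ R := by
  obtain ⟨M, hM⟩ := hv.exists_norm_le
  obtain ⟨C, hC⟩ := isCompact_Icc.exists_bound_of_continuousOn hy
  obtain ⟨X, hX⟩ := hx.norm.bddAbove_range
  refine ⟨C + X + D * M, fun n t ht => ?_⟩
  have hD0 : 0 ≤ D := (norm_nonneg _).trans (hD n t ht)
  have hint := norm_intervalIntegral_clm_apply_le ((hB' n).continuousOn y hy) (v' n) (hD n) ht
  calc _ ≤ ‖y t‖ + ‖x' n‖ + ‖∫ s in (0 : ℝ)..t, B' n s (y s) (v' n s)‖ :=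
        (_root_.norm_sub_le _ _).trans (add_le_add_left (_root_.norm_sub_le _ _) _)
    _ ≤ C + X + D * M := by
        gcongr
        · exact hC t ht
        · exact hX (mem_range_self n)
        · exact hint.trans (mul_le_mul_of_nonneg_left (hM n) hD0)

theorem IsSolution.tendsto [FiniteDimensional ℝ Z] {z' : ℕ → ℝ → Z}
    (hB' : ∀ n, IsLipschitzField (B' n) c)
    (h : IsSolution B v x y) (h' : ∀ n, IsSolution (B' n) (v' n) (x' n) (z' n))
    (hx : Tendsto x' atTop (𝓝 x)) (hv : WeakTendsto v' v)
    (hD : ∀ n, ∀ s ∈ Icc (0 : ℝ) 1, ‖B' n s (y s)‖ ≤ D)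
    (hlim : ∀ s ∈ Icc (0 : ℝ) 1, Tendsto (fun n => B' n s (y s)) atTop (𝓝 (B s (y s))))
    {t : ℝ} (ht : t ∈ Icc (0 : ℝ) 1) : Tendsto (fun n => z' n t) atTop (𝓝 (y t)) := by
  obtain ⟨M, hM⟩ := hv.exists_norm_le
  obtain ⟨R, hR⟩ := exists_norm_residual_le hB' h.continuousOn hx hv hD
  set ρ : ℕ → ℝ → Z := fun n => residual (B' n) (v' n) (x' n) y
  have hρ0 {t : ℝ} (ht : t ∈ Icc (0 : ℝ) 1) : Tendsto (fun n => 2 * ‖ρ n t‖ ^ 2) atTop (𝓝 0) := by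
    simpa using ((h.tendsto_residual hB' hx hv hD hlim ht).norm.pow 2).const_mul 2
  have hmem {s : ℝ} (hs : s ∈ uIoc (0 : ℝ) 1) : s ∈ Icc (0 : ℝ) 1 :=
    Ioc_subset_Icc_self (uIoc_of_le (zero_le_one' ℝ) ▸ hs)
  have hint : Tendsto (fun n => ∫ s in (0 : ℝ)..1, 2 * ‖ρ n s‖ ^ 2) atTop (𝓝 0) := by
    suffices Tendsto (fun n => ∫ s in (0 : ℝ)..1, 2 * ‖ρ n s‖ ^ 2) atTop
        (𝓝 (∫ _ in (0 : ℝ)..1, (0 : ℝ))) by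
      simpa only [intervalIntegral.integral_zero] using this
    refine intervalIntegral.tendsto_integral_filter_of_dominated_convergence (fun _ => 2 * R ^ 2)
      (Eventually.of_forall fun n => ?_)
      (Eventually.of_forall fun n => Eventually.of_forall fun s hs => ?_)
      intervalIntegrable_const (Eventually.of_forall fun s hs => hρ0 (hmem hs))
    · have hcont := (hB' n).continuousOn_residual (v' n) (x' n) h.continuousOn
      exact (((hcont.norm.pow 2).const_mul 2).mono fun s => hmem).aestronglyMeasurable
        measurableSet_uIoc
    · rw [Real.norm_of_nonneg (by positivity)]
      gcongr
      exact hR n s (hmem hs)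
  have hsq : Tendsto (fun n => ‖y t - z' n t‖ ^ 2) atTop (𝓝 0) := by
    refine squeeze_zero (g := fun n => 2 * ‖ρ n t‖ ^ 2 + 2 * (c * M) ^ 2 *
      (Real.exp (2 * (c * M) ^ 2) * ∫ s in (0 : ℝ)..1, 2 * ‖ρ n s‖ ^ 2))
      (fun _ => sq_nonneg _) (fun n => ?_)
      (by simpa using (hρ0 ht).add ((hint.const_mul _).const_mul (2 * (c * M) ^ 2)))
    have hnonneg : 0 ≤ ∫ s in (0 : ℝ)..1, 2 * ‖ρ n s‖ ^ 2 :=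
      intervalIntegral.integral_nonneg zero_le_one fun _ _ => by positivity
    refine ((h' n).norm_sub_sq_le (hB' n) h.continuousOn ht).trans ?_
    gcongr <;> exact hM n
  simpa [tendsto_iff_norm_sub_tendsto_zero, norm_sub_rev] using hsq.sqrt

end Convergence

end ControlledODE

/-! ### Flows of differentiable fields -/

theorem norm_sub_sub_fderiv_le_of_lipschitzWith {E F : Type*} [NormedAddCommGroup E]
    [NormedSpace ℝ E] [NormedAddCommGroup F] [NormedSpace ℝ F] {f : E → F} {K : NNReal}
    (hf : Differentiable ℝ f) (hf' : LipschitzWith K (fderiv ℝ f)) (y z : E) :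
    ‖f z - f y - fderiv ℝ f y (z - y)‖ ≤ K * ‖z - y‖ ^ 2 := by
  have hball {w : E} (hw : w ∈ Metric.closedBall y ‖z - y‖) :
      ‖fderiv ℝ f w - fderiv ℝ f y‖ ≤ K * ‖z - y‖ := by
    refine (hf'.norm_sub_le w y).trans ?_
    gcongr
    exact mem_closedBall_iff_norm.mp hw
  refine (Convex.norm_image_sub_le_of_norm_fderiv_le' (𝕜 := ℝ) (fun w _ => hf w)
    (fun w => hball) (convex_closedBall _ _) (Metric.mem_closedBall_self (norm_nonneg _))
    (mem_closedBall_iff_norm.mpr le_rfl)).trans_eq ?_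
  ring

section Flow

variable {V : Type*} [NormedAddCommGroup V] [NormedSpace ℝ V]
  {Z : Type*} [NormedAddCommGroup Z] [NormedSpace ℝ Z]

/-- A field of operators that is Lipschitz together with its differential. For the evaluation
`B z u = u z` of a space `V` of vector fields, this expresses in one object that `V` is
continuously embedded in the bounded `C¹` fields with Lipschitz differential. -/
structure IsC11Field (B : Z → V →L[ℝ] Z) (c : NNReal) : Prop where
  differentiable : Differentiable ℝ B
  lipschitzWith : LipschitzWith c B
  lipschitzWith_fderiv : LipschitzWith c (fderiv ℝ B)

/-- `φ` is the flow, on the time interval `[0, 1]`, of the equation `ż = B(z) v`. -/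
def IsControlFlow (B : Z → V →L[ℝ] Z) (v : TimeL2 V) (φ : ℝ → Z → Z) : Prop :=
  ∀ x, IsSolution (fun _ => B) v x fun t => φ t x

/-- The field of the equation linearized along the curve `y`, acting on operators so that it
governs the differential of the flow: `linearizedField B y s Y u k = DB(y s)(Y k) u`. -/
noncomputable def linearizedField (B : Z → V →L[ℝ] Z) (y : ℝ → Z) (s : ℝ) (Y : Z →L[ℝ] Z) :
    V →L[ℝ] (Z →L[ℝ] Z) :=
  (ContinuousLinearMap.compL ℝ Z Z Z).flip Y ∘L (fderiv ℝ B (y s)).flip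

variable {B : Z → V →L[ℝ] Z} {c : NNReal} {v : TimeL2 V} {x : Z} {y : ℝ → Z}
  {φ : ℝ → Z → Z}

namespace IsC11Field

theorem isLipschitzField (hB : IsC11Field B c) : IsLipschitzField (fun _ => B) c :=
  ⟨fun _ hz => hB.lipschitzWith.continuous.comp_continuousOn hz, fun _ _ => hB.lipschitzWith⟩

theorem norm_fderiv_le (hB : IsC11Field B c) (z : Z) : ‖fderiv ℝ B z‖ ≤ c :=
  norm_fderiv_le_of_lipschitz ℝ hB.lipschitzWith

theorem isLipschitzField_fderiv (hB : IsC11Field B c) (hy : ContinuousOn y (Icc 0 1)) :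
    IsLipschitzField (fun s w => fderiv ℝ B (y s) w) c := by
  refine ⟨fun w hw => ?_, fun s _ => LipschitzWith.of_dist_le_mul fun w w' => ?_⟩
  · exact (hB.lipschitzWith_fderiv.continuous.comp_continuousOn hy).clm_apply hw
  · rw [dist_eq_norm, dist_eq_norm, ← map_sub]
    exact (fderiv ℝ B (y s)).le_of_opNorm_le (hB.norm_fderiv_le _) _

theorem norm_linearizedField_le (hB : IsC11Field B c) (y : ℝ → Z) (s : ℝ) (Y : Z →L[ℝ] Z) :
    ‖linearizedField B y s Y‖ ≤ c * ‖Y‖ := by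
  refine ContinuousLinearMap.opNorm_le_bound _ (by positivity) fun u => ?_
  calc ‖(fderiv ℝ B (y s)).flip u ∘L Y‖ ≤ ‖(fderiv ℝ B (y s)).flip u‖ * ‖Y‖ :=
        ContinuousLinearMap.opNorm_comp_le _ _
    _ ≤ c * ‖u‖ * ‖Y‖ := by
        gcongr
        refine ContinuousLinearMap.le_of_opNorm_le _ ?_ u
        exact (ContinuousLinearMap.opNorm_flip _).trans_le (hB.norm_fderiv_le _)
    _ = c * ‖Y‖ * ‖u‖ := by ring

theorem isLipschitzField_linearizedField (hB : IsC11Field B c) (hy : ContinuousOn y (Icc 0 1)) :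
    IsLipschitzField (linearizedField B y) c := by
  refine ⟨fun Y hY => ?_, fun s _ => LipschitzWith.of_dist_le_mul fun Y Y' => ?_⟩
  · exact ((ContinuousLinearMap.compL ℝ Z Z Z).flip.continuous.comp_continuousOn hY).clm_comp
      ((ContinuousLinearMap.flipₗᵢ ℝ Z V Z).continuous.comp_continuousOn
        (hB.lipschitzWith_fderiv.continuous.comp_continuousOn hy))
  · have hsub : linearizedField B y s Y - linearizedField B y s Y' =
        linearizedField B y s (Y - Y') := by
      simp only [linearizedField, map_sub, ContinuousLinearMap.sub_comp]
    rw [dist_eq_norm (linearizedField B y s Y), dist_eq_norm Y, hsub]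
    exact hB.norm_linearizedField_le _ _ _

end IsC11Field

theorem IsSolution.apply {Y₀ : Z →L[ℝ] Z} {Y : ℝ → Z →L[ℝ] Z} (hB : IsC11Field B c)
    (hy : ContinuousOn y (Icc 0 1)) (hY : IsSolution (linearizedField B y) v Y₀ Y) (k : Z) :
    IsSolution (fun s w => fderiv ℝ B (y s) w) v (Y₀ k) fun t => Y t k := by
  refine ⟨hY.continuousOn.clm_apply continuousOn_const, fun t ht => ?_⟩
  have hint := intervalIntegrable_clm_apply
    ((hB.isLipschitzField_linearizedField hy).continuousOn Y hY.continuousOn) v le_rfl ht.1 ht.2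
  conv_lhs => rw [hY.eq_integral t ht]
  rw [add_apply, ContinuousLinearMap.intervalIntegral_apply hint]
  rfl

theorem IsSolution.congr {B : ℝ → Z → V →L[ℝ] Z} {z : ℝ → Z} (h : IsSolution B v x y)
    (hyz : EqOn y z (Icc 0 1)) : IsSolution B v x z := by
  refine ⟨h.continuousOn.congr fun t ht => (hyz ht).symm, fun t ht => ?_⟩
  rw [← hyz ht, h.eq_integral t ht]
  congr 1
  refine intervalIntegral.integral_congr fun s hs => ?_
  rw [uIcc_of_le ht.1] at hs
  simp only [hyz ⟨hs.1, hs.2.trans ht.2⟩]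

theorem IsSolution.norm_le_growth {Y : ℝ → Z →L[ℝ] Z} (hB : IsC11Field B c)
    (hy : ContinuousOn y (Icc 0 1))
    (hY : IsSolution (linearizedField B y) v (ContinuousLinearMap.id ℝ Z) Y) {t : ℝ}
    (ht : t ∈ Icc (0 : ℝ) 1) : ‖Y t‖ ≤ growth (c * ‖v‖) := by
  have h0 : IsSolution (linearizedField B y) v 0 fun _ => 0 :=
    ⟨continuousOn_const, fun t _ => by simp [linearizedField]⟩
  have hle := h0.norm_sub_le (hB.isLipschitzField_linearizedField hy) hY ht
  rw [sub_zero, sub_zero] at hle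
  exact hle.trans
    (mul_le_of_le_one_right (growth_nonneg _) ContinuousLinearMap.norm_id_le)

theorem IsSolution.residual_add {w : ℝ → Z} {k : Z} (hB : IsC11Field B c)
    (hy : IsSolution (fun _ => B) v x y)
    (hw : IsSolution (fun s w => fderiv ℝ B (y s) w) v k w) {t : ℝ} (ht : t ∈ Icc (0 : ℝ) 1) :
    residual (fun _ => B) v (x + k) (fun s => y s + w s) t =
      -∫ s in (0 : ℝ)..t, (B (y s + w s) - B (y s) - fderiv ℝ B (y s) (w s)) (v s) := by
  have hyw : ContinuousOn (fun s => B (y s + w s)) (Icc 0 1) :=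
    hB.isLipschitzField.continuousOn _ (hy.continuousOn.add hw.continuousOn)
  have hBy := hB.isLipschitzField.continuousOn _ hy.continuousOn
  have hDw := (hB.isLipschitzField_fderiv hy.continuousOn).continuousOn _ hw.continuousOn
  have hint {G : ℝ → V →L[ℝ] Z} (hG : ContinuousOn G (Icc 0 1)) :=
    intervalIntegrable_clm_apply hG v le_rfl ht.1 ht.2
  simp only [sub_apply]
  rw [intervalIntegral.integral_sub ((hint hyw).sub (hint hBy)) (hint hDw),
    intervalIntegral.integral_sub (hint hyw) (hint hBy), residual, hy.eq_integral t ht,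
    hw.eq_integral t ht]
  abel

namespace IsControlFlow

theorem norm_add_sub_le {Y : ℝ → Z →L[ℝ] Z} (hB : IsC11Field B c) (hφ : IsControlFlow B v φ)
    (hY : IsSolution (linearizedField B fun t => φ t x) v (ContinuousLinearMap.id ℝ Z) Y) (k : Z)
    {t : ℝ} (ht : t ∈ Icc (0 : ℝ) 1) :
    ‖φ t x + Y t k - φ t (x + k)‖ ≤
      growth (c * ‖v‖) * (c * (growth (c * ‖v‖) * ‖k‖) ^ 2 * ‖v‖) := by
  have hφc := (hφ x).continuousOn
  have hYk := hY.apply hB hφc k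
  -- The first-order expansion solves the equation started at `x + k` up to the Taylor remainder.
  refine (hφ (x + k)).norm_sub_le_of_residual_le (z := fun s => φ s x + Y s k)
    hB.isLipschitzField (hφc.add hYk.continuousOn) (fun t ht => ?_) ht
  rw [ContinuousLinearMap.id_apply] at hYk
  rw [(hφ x).residual_add hB hYk ht, norm_neg]
  refine norm_intervalIntegral_clm_apply_le ?_ v (fun s hs => ?_) ht
  · exact ((hB.isLipschitzField.continuousOn _ (hφc.add hYk.continuousOn)).sub
      (hB.isLipschitzField.continuousOn _ hφc)).sub
      ((hB.isLipschitzField_fderiv hφc).continuousOn _ hYk.continuousOn)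
  · have htaylor := norm_sub_sub_fderiv_le_of_lipschitzWith hB.differentiable
      hB.lipschitzWith_fderiv (φ s x) (φ s x + Y s k)
    rw [add_sub_cancel_left] at htaylor
    refine htaylor.trans ?_
    gcongr
    exact (Y s).le_of_opNorm_le (hY.norm_le_growth hB hφc hs) k

theorem hasFDerivAt {Y : ℝ → Z →L[ℝ] Z} (hB : IsC11Field B c) (hφ : IsControlFlow B v φ)
    (hY : IsSolution (linearizedField B fun t => φ t x) v (ContinuousLinearMap.id ℝ Z) Y) {t : ℝ}
    (ht : t ∈ Icc (0 : ℝ) 1) : HasFDerivAt (φ t) (Y t) x := by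
  rw [hasFDerivAt_iff_isLittleO_nhds_zero]
  refine Asymptotics.IsBigO.trans_isLittleO (Asymptotics.IsBigO.of_bound
    (growth (c * ‖v‖) * (c * growth (c * ‖v‖) ^ 2 * ‖v‖)) (Eventually.of_forall fun k => ?_))
    (Asymptotics.isLittleO_norm_pow_id one_lt_two)
  rw [← norm_neg, neg_sub, sub_sub_eq_add_sub, norm_pow, norm_norm, add_comm (Y t k)]
  refine (hφ.norm_add_sub_le hB hY k ht).trans_eq ?_
  ring

theorem isSolution_fderiv [CompleteSpace Z] (hB : IsC11Field B c) (hφ : IsControlFlow B v φ)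
    (x : Z) : IsSolution (linearizedField B fun t => φ t x) v (ContinuousLinearMap.id ℝ Z)
      fun t => fderiv ℝ (φ t) x := by
  obtain ⟨Y, hY⟩ := (hB.isLipschitzField_linearizedField (hφ x).continuousOn).exists_isSolution v
    (ContinuousLinearMap.id ℝ Z)
  exact hY.congr fun t ht => (hφ.hasFDerivAt hB hY ht).fderiv.symm

theorem norm_fderiv_le [CompleteSpace Z] (hB : IsC11Field B c) (hφ : IsControlFlow B v φ)
    {t : ℝ} (ht : t ∈ Icc (0 : ℝ) 1) (x : Z) : ‖fderiv ℝ (φ t) x‖ ≤ growth (c * ‖v‖) :=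
  (hφ.isSolution_fderiv hB x).norm_le_growth hB (hφ x).continuousOn ht

theorem injective_fderiv [CompleteSpace Z] (hB : IsC11Field B c) (hφ : IsControlFlow B v φ)
    (x : Z) : Function.Injective (fderiv ℝ (φ 1) x) := by
  refine (injective_iff_map_eq_zero _).mpr fun k hk => ?_
  have hφc := (hφ x).continuousOn
  have hk' := (hφ.isSolution_fderiv hB x).apply hB hφc k
  have h0 : IsSolution (fun s w => fderiv ℝ B (φ s x) w) v 0 fun _ => 0 :=
    ⟨continuousOn_const, fun t _ => by simp⟩
  have hzero : fderiv ℝ (φ 0) x k = 0 :=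
    hk'.eqOn_of_eq_one (hB.isLipschitzField_fderiv hφc) h0 hk (left_mem_Icc.mpr zero_le_one)
  simpa [hzero] using (hk'.eq_integral 0 (left_mem_Icc.mpr zero_le_one)).symm

section Convergence

variable [FiniteDimensional ℝ Z] {v' : ℕ → TimeL2 V} {x' : ℕ → Z} {φ' : ℕ → ℝ → Z → Z}

theorem tendsto (hB : IsC11Field B c) (hφ : IsControlFlow B v φ)
    (hφ' : ∀ n, IsControlFlow B (v' n) (φ' n)) (hv : WeakTendsto v' v)
    (hx : Tendsto x' atTop (𝓝 x)) {t : ℝ} (ht : t ∈ Icc (0 : ℝ) 1) :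
    Tendsto (fun n => φ' n t (x' n)) atTop (𝓝 (φ t x)) := by
  obtain ⟨D, hD⟩ := isCompact_Icc.exists_bound_of_continuousOn
    (hB.isLipschitzField.continuousOn _ (hφ x).continuousOn)
  exact (hφ x).tendsto (fun _ => hB.isLipschitzField) (fun n => hφ' n (x' n)) hx hv
    (fun _ => hD) (fun _ _ => tendsto_const_nhds) ht

theorem tendsto_fderiv (hB : IsC11Field B c) (hφ : IsControlFlow B v φ)
    (hφ' : ∀ n, IsControlFlow B (v' n) (φ' n)) (hv : WeakTendsto v' v)
    (hx : Tendsto x' atTop (𝓝 x)) {t : ℝ} (ht : t ∈ Icc (0 : ℝ) 1) :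
    Tendsto (fun n => fderiv ℝ (φ' n t) (x' n)) atTop (𝓝 (fderiv ℝ (φ t) x)) := by
  have : CompleteSpace Z := FiniteDimensional.complete ℝ Z
  refine (hφ.isSolution_fderiv hB x).tendsto (D := c * growth (c * ‖v‖))
    (fun n => hB.isLipschitzField_linearizedField (hφ' n (x' n)).continuousOn)
    (fun n => (hφ' n).isSolution_fderiv hB (x' n)) tendsto_const_nhds hv
    (fun n s hs => ?_) (fun s hs => ?_) ht
  · refine (hB.norm_linearizedField_le _ _ _).trans ?_
    gcongr
    exact hφ.norm_fderiv_le hB hs x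
  · have hDB : Tendsto (fun n => fderiv ℝ B (φ' n s (x' n))) atTop (𝓝 (fderiv ℝ B (φ s x))) :=
      (hB.lipschitzWith_fderiv.continuous.tendsto _).comp (hφ.tendsto hB hφ' hv hx hs)
    exact (((ContinuousLinearMap.compL ℝ V (Z →L[ℝ] Z) (Z →L[ℝ] Z)
      ((ContinuousLinearMap.compL ℝ Z Z Z).flip (fderiv ℝ (φ s) x))).continuous.comp
      (ContinuousLinearMap.flipₗᵢ ℝ Z V Z).continuous).tendsto _).comp hDB

end Convergence

end IsControlFlow

end Flow

section OfApply

variable {V Z : Type*} [NormedAddCommGroup V] [NormedSpace ℝ V] [NormedAddCommGroup Z]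
  [NormedSpace ℝ Z] {B : Z → V →L[ℝ] Z} {c : NNReal}

theorem lipschitzWith_of_apply {B : Z → V →L[ℝ] Z}
    (hB : ∀ u, LipschitzWith (c * ‖u‖₊) fun z => B z u) : LipschitzWith c B :=
  LipschitzWith.of_dist_le_mul fun y z => by
    rw [dist_eq_norm (B y), dist_eq_norm y]
    refine ContinuousLinearMap.opNorm_le_bound _ (by positivity) fun u => ?_
    exact ((hB u).norm_sub_le y z).trans_eq (mul_right_comm _ _ _)

theorem hasFDerivAt_of_apply {D : V →L[ℝ] Z →L[ℝ] Z} {z : Z}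
    (hB : ∀ u, Differentiable ℝ fun z => B z u)
    (hB' : ∀ u, LipschitzWith (c * ‖u‖₊) (fderiv ℝ fun z => B z u))
    (hD : ∀ u, D u = fderiv ℝ (fun z => B z u) z) : HasFDerivAt B D.flip z := by
  rw [hasFDerivAt_iff_isLittleO_nhds_zero]
  refine Asymptotics.IsBigO.trans_isLittleO (Asymptotics.IsBigO.of_bound (c : ℝ)
    (Eventually.of_forall fun k => ?_)) (Asymptotics.isLittleO_norm_pow_id one_lt_two)
  rw [norm_pow, norm_norm]
  refine ContinuousLinearMap.opNorm_le_bound _ (by positivity) fun u => ?_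
  have htaylor := norm_sub_sub_fderiv_le_of_lipschitzWith (hB u) (hB' u) z (z + k)
  rw [add_sub_cancel_left, ← hD u] at htaylor
  exact htaylor.trans_eq (mul_right_comm _ _ _)

theorem isC11Field_of_apply (hd : ∀ u, Differentiable ℝ fun z => B z u)
    (hB : ∀ u, LipschitzWith (c * ‖u‖₊) fun z => B z u)
    (hB' : ∀ u, LipschitzWith (c * ‖u‖₊) (fderiv ℝ fun z => B z u)) : IsC11Field B c := by
  let D (z : Z) : V →L[ℝ] Z →L[ℝ] Z := LinearMap.mkContinuous
    { toFun := fun u => fderiv ℝ (fun z => B z u) z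
      map_add' := fun u w => by simpa only [map_add] using fderiv_fun_add (hd u z) (hd w z)
      map_smul' := fun r u => by
        simpa only [map_smul, RingHom.id_apply] using fderiv_fun_const_smul (hd u z) r }
    c fun u => norm_fderiv_le_of_lipschitz ℝ (hB u)
  have hD (z : Z) : HasFDerivAt B (D z).flip z := hasFDerivAt_of_apply hd hB' fun _ => rfl
  refine ⟨fun z => (hD z).differentiableAt, lipschitzWith_of_apply hB,
    LipschitzWith.of_dist_le_mul fun y z => ?_⟩
  rw [(hD y).fderiv, (hD z).fderiv, ← ContinuousLinearMap.coe_flipₗᵢ,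
    LinearIsometryEquiv.dist_map, dist_eq_norm (D y), dist_eq_norm y]
  refine ContinuousLinearMap.opNorm_le_bound _ (by positivity) fun u => ?_
  exact ((hB' u).norm_sub_le y z).trans_eq (mul_right_comm _ _ _)

end OfApply

section EvalField

variable {n : ℕ} {V : Type*} [NormedAddCommGroup V] [InnerProductSpace ℝ V]
  [RKHS ℝ V (Euc n) (Euc n)] {c : NNReal}

/-- Evaluation at a point, on a space of vector fields. -/
noncomputable def evalField (V : Type*) [NormedAddCommGroup V] [InnerProductSpace ℝ V]
    [RKHS ℝ V (Euc n) (Euc n)] (x : Euc n) : V →L[ℝ] Euc n :=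
  (ContinuousLinearMap.proj x).comp (RKHS.coeCLM ℝ)

theorem EmbedsInC02.exists_isC11Field (hV : EmbedsInC02 n V) :
    ∃ c, IsC11Field (evalField V) c := by
  obtain ⟨c, hc⟩ := hV
  have hbound {i : ℕ} (hi : i ≤ 2) (u : V) (x : Euc n) :
      ‖iteratedFDeriv ℝ i u x‖ ≤ ↑(c.toNNReal * ‖u‖₊) := by
    refine (((hc u).2 i hi).2 x).trans ?_
    rw [NNReal.coe_mul, coe_nnnorm]
    gcongr
    exact Real.le_coe_toNNReal c
  refine ⟨c.toNNReal, isC11Field_of_apply (fun u => (hc u).1.differentiable two_ne_zero)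
    (fun u => ?_) fun u => ?_⟩
  · refine lipschitzWith_of_nnnorm_fderiv_le ((hc u).1.differentiable two_ne_zero) fun x => ?_
    rw [← NNReal.coe_le_coe, coe_nnnorm, ← norm_iteratedFDeriv_one]
    exact hbound one_le_two u x
  · refine lipschitzWith_of_nnnorm_fderiv_le
      (((hc u).1.fderiv_right (m := 1) le_rfl).differentiable one_ne_zero) fun x => ?_
    rw [← NNReal.coe_le_coe, coe_nnnorm, ← norm_iteratedFDeriv_one, norm_iteratedFDeriv_fderiv]
    exact hbound le_rfl u x

theorem isFlow_iff_isControlFlow {v : TimeL2 V} {φ : ℝ → Euc n → Euc n} :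
    IsFlow v φ ↔ IsControlFlow (evalField V) v φ :=
  forall_congr' fun _ => ⟨fun h => ⟨h.1, h.2⟩, fun h => ⟨h.1, h.2⟩⟩

theorem isFlow_flow (hV : IsC11Field (evalField V) c) (v : TimeL2 V) : IsFlow v (flow v) := by
  have hex : ∃ φ, IsFlow v φ := by
    choose z hz using hV.isLipschitzField.exists_isSolution v
    exact ⟨fun t x => z x t, isFlow_iff_isControlFlow.mpr hz⟩
  rw [flow, dif_pos hex]
  exact hex.choose_spec

theorem isControlFlow_flow (hV : IsC11Field (evalField V) c) (v : TimeL2 V) :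
    IsControlFlow (evalField V) v (flow v) :=
  isFlow_iff_isControlFlow.mp (isFlow_flow hV v)

theorem IsFlow.eq_flow (hV : IsC11Field (evalField V) c) {v : TimeL2 V} {ψ : ℝ → Euc n → Euc n}
    (hψ : IsFlow v ψ) {t : ℝ} (ht : t ∈ Icc (0 : ℝ) 1) : ψ t = flow v t :=
  funext fun x => (isFlow_iff_isControlFlow.mp hψ x).eqOn hV.isLipschitzField
    (isControlFlow_flow hV v x) ht

end EvalField

section Grassmannian

variable {n d : ℕ}

theorem det_gram_pos (u : Frame n d) : 0 < (Matrix.gram ℝ u.1).det :=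
  (Matrix.posDef_gram_of_linearIndependent u.2).det_pos

theorem Frame.continuous_apply (i : Fin d) : Continuous fun u : Frame n d => u.1 i :=
  (_root_.continuous_apply i).comp continuous_subtype_val

/-- The frame obtained from `u` by a change of basis; its orientation is that of `u` when the
determinant is positive. -/
noncomputable def Frame.change (A : Matrix (Fin d) (Fin d) ℝ) (hA : A.det ≠ 0) (u : Frame n d) :
    Frame n d :=
  ⟨fun i => ∑ j, A i j • u.1 j, Matrix.linearIndependent_of_det_gram_ne_zero (𝕜 := ℝ) (by
    rw [det_gram_change A u.1 _ fun _ => rfl]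
    exact mul_ne_zero (pow_ne_zero 2 hA) (det_gram_pos u).ne')⟩

theorem Frame.continuous_change (A : Matrix (Fin d) (Fin d) ℝ) (hA : A.det ≠ 0) :
    Continuous (Frame.change (n := n) A hA) :=
  Continuous.subtype_mk (continuous_pi fun i => continuous_finsetSum _ fun j _ =>
    (Frame.continuous_apply j).const_smul (A i j)) _

theorem isQuotientMap_orientedSpan : IsQuotientMap (orientedSpan (n := n) (d := d)) :=
  isQuotientMap_quotient_mk'

theorem isOpenMap_orientedSpan : IsOpenMap (orientedSpan (n := n) (d := d)) := by
  intro s hs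
  have hsaturation : orientedSpan ⁻¹' (orientedSpan '' s) =
      ⋃ (A : Matrix (Fin d) (Fin d) ℝ) (hA : 0 < A.det), Frame.change A hA.ne' ⁻¹' s := by
    ext w
    simp only [mem_preimage, mem_image, mem_iUnion]
    constructor
    · rintro ⟨u, hu, huw⟩
      obtain ⟨A, hA, h⟩ := Quotient.exact huw.symm
      exact ⟨A, hA, by rwa [show Frame.change A hA.ne' w = u from Subtype.ext (funext h).symm]⟩
    · rintro ⟨A, hA, h⟩
      exact ⟨_, h, (Quotient.sound ⟨A, hA, fun _ => rfl⟩ : orientedSpan w = _).symm⟩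
  rw [← isQuotientMap_orientedSpan.isOpen_preimage, hsaturation]
  exact isOpen_iUnion fun A => isOpen_iUnion fun hA =>
    hs.preimage (Frame.continuous_change A hA.ne')

theorem isOpenQuotientMap_orientedSpan : IsOpenQuotientMap (orientedSpan (n := n) (d := d)) :=
  .of_isOpenMap_isQuotientMap isOpenMap_orientedSpan isQuotientMap_orientedSpan

instance : SecondCountableTopology (OrientedGrassmannian n d) :=
  isQuotientMap_orientedSpan.secondCountableTopology isOpenMap_orientedSpan

theorem continuous_orientedGrassmannianMap :
    Continuous fun p : {L : Euc n →L[ℝ] Euc n // Function.Injective L} × OrientedGrassmannian n d =>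
      p.2.map p.1.1 := by
  rw [← (IsOpenQuotientMap.id.prodMap isOpenQuotientMap_orientedSpan).continuous_comp_iff]
  refine (isQuotientMap_orientedSpan.continuous.comp (Continuous.subtype_mk
    (continuous_pi fun i => (continuous_subtype_val.comp continuous_fst).clm_apply
      ((Frame.continuous_apply i).comp continuous_snd))
    fun p : {L : Euc n →L[ℝ] Euc n // Function.Injective L} × Frame n d =>
      (p.2.map p.1.1 p.1.2).2)).congr fun p => ?_
  exact (OrientedGrassmannian.map_orientedSpan p.1.1 p.1.2 p.2).symm

theorem tendsto_orientedGrassmannianMap {ι : Type*} {l : Filter ι} {L' : ι → Euc n →L[ℝ] Euc n}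
    {L : Euc n →L[ℝ] Euc n} (hL' : ∀ i, Function.Injective (L' i)) (hL : Function.Injective L)
    {U' : ι → OrientedGrassmannian n d} {U : OrientedGrassmannian n d}
    (hLL : Tendsto L' l (𝓝 L)) (hU : Tendsto U' l (𝓝 U)) :
    Tendsto (fun i => (U' i).map (L' i)) l (𝓝 (U.map L)) := by
  have hmap := (continuous_orientedGrassmannianMap (n := n) (d := d)).tendsto (⟨L, hL⟩, U)
  have hLL' : Tendsto (fun i => (⟨L' i, hL' i⟩ : {L : Euc n →L[ℝ] Euc n // Function.Injective L})) l
      (𝓝 ⟨L, hL⟩) := tendsto_subtype_rng.mpr hLL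
  exact hmap.comp (hLL'.prodMk_nhds hU)

theorem jacobianAlong_orientedSpan (L : Euc n →L[ℝ] Euc n) (u : Frame n d) :
    jacobianAlong L (orientedSpan u) =
      √(Matrix.gram ℝ (fun i => L (u.1 i))).det / √(Matrix.gram ℝ u.1).det := rfl

theorem continuous_sqrt_det_gram {X : Type*} [TopologicalSpace X] {u : X → Fin d → Euc n}
    (hu : ∀ i, Continuous fun x => u x i) : Continuous fun x => √(Matrix.gram ℝ (u x)).det :=
  (Continuous.matrix_det (continuous_matrix fun i j => (hu i).inner (hu j))).sqrt

theorem continuous_jacobianAlong :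
    Continuous fun p : (Euc n →L[ℝ] Euc n) × OrientedGrassmannian n d =>
      jacobianAlong p.1 p.2 := by
  rw [← (IsOpenQuotientMap.id.prodMap isOpenQuotientMap_orientedSpan).continuous_comp_iff]
  have hu (i : Fin d) : Continuous fun p : (Euc n →L[ℝ] Euc n) × Frame n d => p.2.1 i :=
    (Frame.continuous_apply i).comp continuous_snd
  exact (continuous_sqrt_det_gram fun i => continuous_fst.clm_apply (hu i)).div
    (continuous_sqrt_det_gram hu) fun p => (Real.sqrt_pos.mpr (det_gram_pos p.2)).ne'

theorem tendsto_jacobianAlong {ι : Type*} {l : Filter ι} {L' : ι → Euc n →L[ℝ] Euc n}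
    {L : Euc n →L[ℝ] Euc n} {U' : ι → OrientedGrassmannian n d} {U : OrientedGrassmannian n d}
    (hL : Tendsto L' l (𝓝 L)) (hU : Tendsto U' l (𝓝 U)) :
    Tendsto (fun i => jacobianAlong (L' i) (U' i)) l (𝓝 (jacobianAlong L U)) := by
  have hJ := (continuous_jacobianAlong (n := n) (d := d)).tendsto (L, U)
  simpa only [Function.comp_def] using hJ.comp (hL.prodMk_nhds hU)

theorem jacobianAlong_nonneg (L : Euc n →L[ℝ] Euc n) (U : OrientedGrassmannian n d) :
    0 ≤ jacobianAlong L U := by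
  obtain ⟨u, rfl⟩ := isQuotientMap_orientedSpan.surjective U
  rw [jacobianAlong_orientedSpan]
  positivity

theorem exists_orthonormal_jacobianAlong_eq (U : OrientedGrassmannian n d) :
    ∃ w : Fin d → Euc n, Orthonormal ℝ w ∧
      ∀ L : Euc n →L[ℝ] Euc n, jacobianAlong L U = √(Matrix.gram ℝ fun i => L (w i)).det := by
  obtain ⟨u, rfl⟩ := isQuotientMap_orientedSpan.surjective U
  let w : Fin d → Euc n := InnerProductSpace.gramSchmidtNormed ℝ u.1
  have hw : Orthonormal ℝ w := InnerProductSpace.gramSchmidtNormed_orthonormal u.2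
  have hspan (i : Fin d) : ∃ a : Fin d → ℝ, ∑ j, a j • w j = u.1 i := by
    rw [← Submodule.mem_span_range_iff_exists_fun, InnerProductSpace.span_gramSchmidtNormed_range,
      InnerProductSpace.span_gramSchmidt]
    exact Submodule.subset_span (mem_range_self i)
  choose A hA using hspan
  have hgram := det_gram_change (Matrix.of A) w u.1 fun i => (hA i).symm
  rw [Matrix.gram_eq_one_iff_orthonormal.mpr hw, Matrix.det_one, mul_one] at hgram
  have hpos := det_gram_pos u
  rw [hgram] at hpos
  refine ⟨w, hw, fun L => ?_⟩
  have hgramL := det_gram_change (Matrix.of A) (fun i => L (w i)) (fun i => L (u.1 i)) fun i => by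
    simp [← hA i]
  rw [jacobianAlong_orientedSpan, hgram, hgramL, Real.sqrt_mul hpos.le,
    mul_div_cancel_left₀ _ (Real.sqrt_pos.mpr hpos).ne']

theorem jacobianAlong_le (L : Euc n →L[ℝ] Euc n) (U : OrientedGrassmannian n d) :
    jacobianAlong L U ≤ √(d.factorial : ℝ) * ‖L‖ ^ d := by
  obtain ⟨w, hw, hJ⟩ := exists_orthonormal_jacobianAlong_eq U
  have hLw (i : Fin d) : ‖L (w i)‖ ≤ ‖L‖ := by simpa only [hw.1 i, mul_one] using L.le_opNorm (w i)
  have hentry (i j : Fin d) :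
      AbsoluteValue.abs (Matrix.gram ℝ (fun i => L (w i)) i j) ≤ ‖L‖ ^ 2 := by
    rw [Matrix.gram_apply, sq]
    exact (abs_real_inner_le_norm _ _).trans
      (mul_le_mul (hLw i) (hLw j) (norm_nonneg _) (norm_nonneg _))
  have hdet := (le_abs_self _).trans (Matrix.det_le hentry)
  rw [Fintype.card_fin, nsmul_eq_mul, ← pow_mul, mul_comm 2, pow_mul] at hdet
  rw [hJ]
  exact (Real.sqrt_le_sqrt hdet).trans_eq
    (by rw [Real.sqrt_mul (by positivity), Real.sqrt_sq (by positivity)])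

end Grassmannian

section Pullback

variable {n d : ℕ} {ω : Euc n × OrientedGrassmannian n d → ℝ}

/-- The pullback of a test function by a deformation `φ`, dual to `pushforward φ`. -/
noncomputable def pullback (φ : Euc n → Euc n) (ω : Euc n × OrientedGrassmannian n d → ℝ)
    (p : Euc n × OrientedGrassmannian n d) : ℝ :=
  ω (φ p.1, p.2.map (fderiv ℝ φ p.1)) * jacobianAlong (fderiv ℝ φ p.1) p.2

theorem tendsto_pullback {ι : Type*} {l : Filter ι} {φ' : ι → Euc n → Euc n} {φ : Euc n → Euc n}
    {p' : ι → Euc n × OrientedGrassmannian n d} {p : Euc n × OrientedGrassmannian n d}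
    (hω : Continuous ω) (hp : Tendsto p' l (𝓝 p))
    (hφ : Tendsto (fun i => φ' i (p' i).1) l (𝓝 (φ p.1)))
    (hD : Tendsto (fun i => fderiv ℝ (φ' i) (p' i).1) l (𝓝 (fderiv ℝ φ p.1)))
    (hinj' : ∀ i, Function.Injective (fderiv ℝ (φ' i) (p' i).1))
    (hinj : Function.Injective (fderiv ℝ φ p.1)) :
    Tendsto (fun i => pullback (φ' i) ω (p' i)) l (𝓝 (pullback φ ω p)) := by
  have hU : Tendsto (fun i => (p' i).2) l (𝓝 p.2) := (continuous_snd.tendsto p).comp hp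
  have hmap := tendsto_orientedGrassmannianMap hinj' hinj hD hU
  have hωφ := (hω.tendsto _).comp (hφ.prodMk_nhds hmap)
  simpa only [Function.comp_def, pullback] using hωφ.mul (tendsto_jacobianAlong hD hU)

theorem abs_pullback_le {φ : Euc n → Euc n} {C : ℝ} (hω : ∀ p, |ω p| ≤ C)
    (p : Euc n × OrientedGrassmannian n d) :
    |pullback φ ω p| ≤ C * (√(d.factorial : ℝ) * ‖fderiv ℝ φ p.1‖ ^ d) := by
  rw [pullback, abs_mul, abs_of_nonneg (jacobianAlong_nonneg _ _)]
  exact mul_le_mul (hω _) (jacobianAlong_le _ _) (jacobianAlong_nonneg _ _)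
    ((abs_nonneg _).trans (hω p))

variable {V : Type*} [NormedAddCommGroup V] [InnerProductSpace ℝ V] [RKHS ℝ V (Euc n) (Euc n)]
  {c : NNReal}

theorem WeakTendsto.tendsto_pullback_flow (hV : IsC11Field (evalField V) c) {v' : ℕ → TimeL2 V}
    {v : TimeL2 V} (hv : WeakTendsto v' v) (hω : Continuous ω)
    {p' : ℕ → Euc n × OrientedGrassmannian n d} {p : Euc n × OrientedGrassmannian n d}
    (hp : Tendsto p' atTop (𝓝 p)) :
    Tendsto (fun n => pullback (flow (v' n) 1) ω (p' n)) atTop (𝓝 (pullback (flow v 1) ω p)) := by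
  have hx : Tendsto (fun n => (p' n).1) atTop (𝓝 p.1) := (continuous_fst.tendsto p).comp hp
  have hφ := isControlFlow_flow hV
  have h1 : (1 : ℝ) ∈ Icc (0 : ℝ) 1 := right_mem_Icc.mpr zero_le_one
  exact tendsto_pullback hω hp ((hφ v).tendsto hV (fun n => hφ (v' n)) hv hx h1)
    ((hφ v).tendsto_fderiv hV (fun n => hφ (v' n)) hv hx h1)
    (fun n => (hφ (v' n)).injective_fderiv hV _) ((hφ v).injective_fderiv hV _)

theorem continuous_pullback_flow (hV : IsC11Field (evalField V) c) (v : TimeL2 V)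
    (hω : Continuous ω) : Continuous (pullback (flow v 1) ω) :=
  SeqContinuous.continuous fun _ _ hp => (weakTendsto_const v).tendsto_pullback_flow hV hω hp

theorem abs_pullback_flow_le (hV : IsC11Field (evalField V) c) {v : TimeL2 V} {M C : ℝ}
    (hv : ‖v‖ ≤ M) (hω : ∀ p, |ω p| ≤ C) (p : Euc n × OrientedGrassmannian n d) :
    |pullback (flow v 1) ω p| ≤ C * (√(d.factorial : ℝ) * growth (c * M) ^ d) := by
  have hC : 0 ≤ C := (abs_nonneg _).trans (hω p)
  refine (abs_pullback_le hω p).trans ?_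
  gcongr
  exact ((isControlFlow_flow hV v).norm_fderiv_le hV (right_mem_Icc.mpr zero_le_one) p.1).trans
    (growth_le_growth (by positivity) (by gcongr))

end Pullback

section DirectMethod

theorem tendsto_min_of_forall_eventually_lt {ι : Type*} {l : Filter ι} {f : ι → ℝ} {a : ℝ}
    (hf : ∀ r < a, ∀ᶠ i in l, r < f i) : Tendsto (fun i => min (f i) a) l (𝓝 a) :=
  tendsto_order.mpr ⟨fun r hr => (hf r hr).mono fun _ hi => lt_min hi hr,
    fun _ hr => Eventually.of_forall fun _ => (min_le_right _ _).trans_lt hr⟩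

theorem exists_isMinOn_of_forall_seq {X : Type*} {S : Set X} {E : X → ℝ} (hS : S.Nonempty)
    (hE : BddBelow (E '' S))
    (hseq : ∀ (x : ℕ → X) (e : ℝ), (∀ n, x n ∈ S) → Tendsto (fun n => E (x n)) atTop (𝓝 e) →
      ∃ y ∈ S, E y ≤ e) : ∃ y ∈ S, IsMinOn E S y := by
  obtain ⟨r, -, hr, hrS⟩ := exists_seq_tendsto_sInf (hS.image E) hE
  choose x hxS hxr using hrS
  obtain ⟨y, hyS, hy⟩ := hseq x _ hxS (by simpa only [hxr] using hr)
  exact ⟨y, hyS, isMinOn_iff.mpr fun z hz => hy.trans (csInf_le hE ⟨z, hz, rfl⟩)⟩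

end DirectMethod

section Pairing

variable {X Y : Type*} [MeasurableSpace X] [MeasurableSpace Y] {μ : Measure (X × Y)}
  [IsFiniteMeasure μ]

theorem abs_integral_comp_fst_mul_le (α : Lp ℝ 2 μ.fst) {f : X × Y → ℝ} {C : ℝ}
    (hC : ∀ p, |f p| ≤ C) : |∫ p, α p.1 * f p ∂μ| ≤ C * ∫ p, |α p.1| ∂μ := by
  have hα : Integrable (fun p => α p.1) μ :=
    ((Lp.memLp α).integrable one_le_two).comp_measurable measurable_fst
  rw [← integral_const_mul, ← Real.norm_eq_abs]
  refine norm_integral_le_of_norm_le (hα.abs.const_mul C) (Eventually.of_forall fun p => ?_)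
  rw [Real.norm_eq_abs, abs_mul, mul_comm]
  exact mul_le_mul_of_nonneg_right (hC p) (abs_nonneg _)

theorem WeakTendsto.tendsto_integral_comp_fst_mul {α' : ℕ → Lp ℝ 2 μ.fst} {α : Lp ℝ 2 μ.fst}
    (hα : WeakTendsto α' α) {f' : ℕ → X × Y → ℝ} {f : X × Y → ℝ} {C : ℝ}
    (hf' : ∀ n, AEStronglyMeasurable (f' n) μ) (hC : ∀ n p, |f' n p| ≤ C)
    (hlim : ∀ p, Tendsto (fun n => f' n p) atTop (𝓝 (f p))) :
    Tendsto (fun n => ∫ p, α' n p.1 * f' n p ∂μ) atTop (𝓝 (∫ p, α p.1 * f p ∂μ)) := by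
  have hfst : MeasurePreserving Prod.fst μ μ.fst := ⟨measurable_fst, rfl⟩
  have hpair (β : Lp ℝ 2 μ.fst) (g : X × Y → ℝ) :
      ∫ p, ContinuousLinearMap.mul ℝ ℝ (g p) (Lp.compMeasurePreservingₗᵢ ℝ Prod.fst hfst β p) ∂μ =
        ∫ p, β p.1 * g p ∂μ := by
    refine integral_congr_ae ?_
    filter_upwards [Lp.coeFn_compMeasurePreserving β hfst] with p hp
    rw [ContinuousLinearMap.mul_apply', mul_comm]
    exact congrArg (· * g p) hp
  simp only [← hpair]
  exact (hα.map (Lp.compMeasurePreservingₗᵢ ℝ Prod.fst hfst).toContinuousLinearMap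
    ).tendsto_integral_bilin _ hf' (fun n => Eventually.of_forall (hC n))
    (Eventually.of_forall hlim)

end Pairing

section DualNorm

variable {n d : ℕ} {W : Type*} [NormedAddCommGroup W] [InnerProductSpace ℝ W]
  [RKHS ℝ W (Euc n × OrientedGrassmannian n d) ℝ] {T : Distr n d}

theorem dualNorm_nonneg (hT : T 0 = 0) : 0 ≤ dualNorm W T :=
  Real.sSup_nonneg' ⟨0, ⟨0, by simp, by rw [RKHS.coe_zero, hT]⟩, le_rfl⟩

theorem le_dualNorm {C : ℝ} (hT : ∀ ω : W, ‖ω‖ ≤ 1 → T ω ≤ C) {ω : W} (hω : ‖ω‖ ≤ 1) :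
    T ω ≤ dualNorm W T := by
  refine le_csSup ⟨C, ?_⟩ ⟨ω, hω, rfl⟩
  rintro _ ⟨ω', hω', rfl⟩
  exact hT ω' hω'

theorem eventually_lt_dualNorm {ι : Type*} {l : Filter ι} {T' : ι → Distr n d} {C : ι → ℝ}
    (hT' : ∀ i, ∀ ω : W, ‖ω‖ ≤ 1 → T' i ω ≤ C i)
    (hlim : ∀ ω : W, Tendsto (fun i => T' i ω) l (𝓝 (T ω))) {r : ℝ} (hr : r < dualNorm W T) :
    ∀ᶠ i in l, r < dualNorm W (T' i) := by
  have hne : {r | ∃ ω : W, ‖ω‖ ≤ 1 ∧ r = T ⇑ω}.Nonempty := ⟨_, 0, by simp, rfl⟩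
  obtain ⟨_, ⟨ω, hω, rfl⟩, hrω⟩ := exists_lt_of_lt_csSup hne hr
  filter_upwards [(hlim ω).eventually_const_lt hrω] with i hi
  exact hi.trans_le (le_dualNorm (hT' i) hω)

end DualNorm

section Discrepancy

variable {n d : ℕ} {V : Type*} [NormedAddCommGroup V] [InnerProductSpace ℝ V]
  [RKHS ℝ V (Euc n) (Euc n)] {c : NNReal}
  {W : Type*} [NormedAddCommGroup W] [InnerProductSpace ℝ W]
  [RKHS ℝ W (Euc n × OrientedGrassmannian n d) ℝ] {C : ℝ}
  {μ μ' : Measure (Euc n × OrientedGrassmannian n d)}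

/-- The Hilbert space `W` of functions embeds in the bounded continuous functions on `X`, with
embedding constant `C`. -/
structure IsBoundedEmbedding {X : Type*} [TopologicalSpace X] (W : Type*) [NormedAddCommGroup W]
    [InnerProductSpace ℝ W] [RKHS ℝ W X ℝ] (C : ℝ) : Prop where
  continuous : ∀ ω : W, Continuous ω
  abs_le : ∀ (ω : W) p, |ω p| ≤ C * ‖ω‖

theorem EmbedsInC01.exists_isBoundedEmbedding (hW : EmbedsInC01 n d W) :
    ∃ C, IsBoundedEmbedding W C := by
  obtain ⟨C, hC⟩ := hW
  refine ⟨C, fun ω => ?_, fun ω => (hC ω).2.1⟩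
  obtain ⟨f, hf⟩ := (hC ω).1.zero_at_infty
  exact hf ▸ map_continuous f

/-- The discrepancy `(φ₁^v)_# (α μ) - μ'` between the transformed source and the target. -/
noncomputable def discrepancy (μ μ' : Measure (Euc n × OrientedGrassmannian n d)) (v : TimeL2 V)
    (α : Euc n → ℝ) : Distr n d :=
  pushforward (flow v 1) (rescale α μ) - toDistr μ'

theorem discrepancy_apply (v : TimeL2 V) (α : Euc n → ℝ)
    (ω : Euc n × OrientedGrassmannian n d → ℝ) :
    discrepancy μ μ' v α ω = (∫ p, α p.1 * pullback (flow v 1) ω p ∂μ) - ∫ p, ω p ∂μ' := rfl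

theorem discrepancy_zero (v : TimeL2 V) (α : Euc n → ℝ) : discrepancy μ μ' v α 0 = 0 := by
  simp [discrepancy_apply, pullback]

theorem dualNorm_discrepancy_nonneg (v : TimeL2 V) (α : Euc n → ℝ) :
    0 ≤ dualNorm W (discrepancy μ μ' v α) :=
  dualNorm_nonneg (discrepancy_zero v α)

variable [IsFiniteMeasure μ]

theorem discrepancy_le [IsFiniteMeasure μ'] (hV : IsC11Field (evalField V) c) (v : TimeL2 V)
    (α : Lp ℝ 2 μ.fst) {ω : Euc n × OrientedGrassmannian n d → ℝ} (hω : ∀ p, |ω p| ≤ C) :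
    discrepancy μ μ' v α ω ≤
      C * (√(d.factorial : ℝ) * growth (c * ‖v‖) ^ d) * (∫ p, |α p.1| ∂μ) + C * μ'.real univ := by
  have hsource := abs_integral_comp_fst_mul_le α (abs_pullback_flow_le hV (le_refl ‖v‖) hω)
  have htarget : ‖∫ p, ω p ∂μ'‖ ≤ C * μ'.real univ :=
    norm_integral_le_of_norm_le_const (Eventually.of_forall hω)
  rw [discrepancy_apply]
  linarith [(abs_le.mp hsource).2, (abs_le.mp htarget).1]

theorem tendsto_discrepancy (hV : IsC11Field (evalField V) c) {v' : ℕ → TimeL2 V} {v : TimeL2 V}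
    (hv : WeakTendsto v' v) {α' : ℕ → Lp ℝ 2 μ.fst} {α : Lp ℝ 2 μ.fst} (hα : WeakTendsto α' α)
    {ω : Euc n × OrientedGrassmannian n d → ℝ} (hω : Continuous ω) (hC : ∀ p, |ω p| ≤ C) :
    Tendsto (fun m => discrepancy μ μ' (v' m) (α' m) ω) atTop (𝓝 (discrepancy μ μ' v α ω)) := by
  obtain ⟨M, hM⟩ := hv.exists_norm_le
  simp only [discrepancy_apply]
  exact (hα.tendsto_integral_comp_fst_mul
    (fun m => (continuous_pullback_flow hV (v' m) hω).aestronglyMeasurable)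
    (fun m => abs_pullback_flow_le hV (hM m) hC)
    fun p => hv.tendsto_pullback_flow hV hω tendsto_const_nhds).sub_const _

theorem WeakTendsto.eventually_lt_dualNorm_discrepancy [IsFiniteMeasure μ']
    (hV : IsC11Field (evalField V) c) (hW : IsBoundedEmbedding W C)
    {v' : ℕ → TimeL2 V} {v : TimeL2 V} (hv : WeakTendsto v' v)
    {α' : ℕ → Lp ℝ 2 μ.fst} {α : Lp ℝ 2 μ.fst} (hα : WeakTendsto α' α) {r : ℝ}
    (hr : r < dualNorm W (discrepancy μ μ' v α)) :
    ∀ᶠ m in atTop, r < dualNorm W (discrepancy μ μ' (v' m) (α' m)) := by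
  have hunit (ω : W) (hω : ‖ω‖ ≤ 1) (p : Euc n × OrientedGrassmannian n d) : |ω p| ≤ |C| :=
    calc |ω p| ≤ C * ‖ω‖ := hW.abs_le ω p
      _ ≤ |C| * 1 := by gcongr; exact le_abs_self C
      _ = |C| := mul_one _
  exact eventually_lt_dualNorm (fun m ω hω => discrepancy_le hV (v' m) (α' m) (hunit ω hω))
    (fun ω => tendsto_discrepancy hV hv hα (hW.continuous ω) (hW.abs_le ω)) hr

end Discrepancy

section Weights

variable {X : Type*} [MeasurableSpace X] {ν : Measure X}

theorem convex_Ici_zero_Lp {p : ENNReal} : Convex ℝ (Ici (0 : Lp ℝ p ν)) := by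
  intro α hα β hβ a b ha hb _
  rw [mem_Ici, ← Lp.coeFn_nonneg] at *
  filter_upwards [hα, hβ, Lp.coeFn_add (a • α) (b • β), Lp.coeFn_smul a α, Lp.coeFn_smul b β]
    with x hαx hβx hadd hsmul hsmul'
  rw [hadd, Pi.add_apply, hsmul, hsmul']
  exact add_nonneg (mul_nonneg ha hαx) (mul_nonneg hb hβx)

theorem integral_sub_one_sq_eq [IsFiniteMeasure ν]
    (α : Lp ℝ 2 ν) : ∫ x, (α x - 1) ^ 2 ∂ν = ‖α - Lp.const 2 ν 1‖ ^ 2 := by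
  rw [← integral_norm_sq_eq]
  refine integral_congr_ae ?_
  filter_upwards [Lp.coeFn_sub α (Lp.const 2 ν 1), Lp.coeFn_const 2 ν (1 : ℝ)] with x hsub hone
  rw [hsub, Pi.sub_apply, hone, Function.const_apply, Real.norm_eq_abs, sq_abs]

end Weights

section Energy

variable {n d : ℕ} {V : Type*} [NormedAddCommGroup V] [InnerProductSpace ℝ V]
  [RKHS ℝ V (Euc n) (Euc n)] {c : NNReal}
  {W : Type*} [NormedAddCommGroup W] [InnerProductSpace ℝ W]
  [RKHS ℝ W (Euc n × OrientedGrassmannian n d) ℝ] {C : ℝ} {γ lam : ℝ}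
  {μ μ' : Measure (Euc n × OrientedGrassmannian n d)} [IsFiniteMeasure μ]

/- In the definition of `relaxedEnergy` the integral over `[0, 1]` extends over all three summands,
hence the factors `1 / 4`. -/
theorem relaxedEnergy_eq (q : TimeL2 V × Lp ℝ 2 μ.fst) :
    relaxedEnergy W γ lam μ μ' q = 1 / 2 * ‖q.1‖ ^ 2 + γ / 4 * ‖q.2 - Lp.const 2 μ.fst 1‖ ^ 2 +
      lam / 4 * dualNorm W (discrepancy μ μ' q.1 q.2) ^ 2 := by
  have hintegral (a b : ℝ) :
      ∫ t in Icc (0 : ℝ) 1, (‖q.1 t‖ ^ 2 + a + b) = ‖q.1‖ ^ 2 + a + b := by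
    simp only [add_assoc]
    rw [integral_add (Lp.memLp q.1).norm.integrable_sq (integrable_const _), integral_norm_sq_eq]
    simp
  rw [relaxedEnergy, integral_sub_one_sq_eq, hintegral, discrepancy]
  ring

theorem relaxedEnergy_nonneg (hγ : 0 ≤ γ) (hlam : 0 ≤ lam) (q : TimeL2 V × Lp ℝ 2 μ.fst) :
    0 ≤ relaxedEnergy W γ lam μ μ' q := by
  rw [relaxedEnergy_eq]
  positivity

theorem norm_fst_le_of_relaxedEnergy_le (hγ : 0 ≤ γ) (hlam : 0 ≤ lam)
    {q : TimeL2 V × Lp ℝ 2 μ.fst} {b : ℝ} (hq : relaxedEnergy W γ lam μ μ' q ≤ b) :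
    ‖q.1‖ ≤ √(2 * b) := by
  rw [relaxedEnergy_eq] at hq
  refine Real.le_sqrt_of_sq_le ?_
  have hα : 0 ≤ γ / 4 * ‖q.2 - Lp.const 2 μ.fst 1‖ ^ 2 := by positivity
  have hD : 0 ≤ lam / 4 * dualNorm W (discrepancy μ μ' q.1 q.2) ^ 2 := by positivity
  linarith

theorem norm_snd_sub_one_le_of_relaxedEnergy_le (hγ : 0 < γ) (hlam : 0 ≤ lam)
    {q : TimeL2 V × Lp ℝ 2 μ.fst} {b : ℝ} (hq : relaxedEnergy W γ lam μ μ' q ≤ b) :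
    ‖q.2 - Lp.const 2 μ.fst 1‖ ≤ √(4 * b / γ) := by
  rw [relaxedEnergy_eq] at hq
  refine Real.le_sqrt_of_sq_le ((le_div_iff₀' hγ).mpr ?_)
  have hD : 0 ≤ lam / 4 * dualNorm W (discrepancy μ μ' q.1 q.2) ^ 2 := by positivity
  linarith [sq_nonneg ‖q.1‖]

variable [IsFiniteMeasure μ']

theorem relaxedEnergy_le_of_weakTendsto (hV : IsC11Field (evalField V) c)
    (hW : IsBoundedEmbedding W C) (hγ : 0 ≤ γ) (hlam : 0 ≤ lam)
    {q' : ℕ → TimeL2 V × Lp ℝ 2 μ.fst} {v : TimeL2 V} {α : Lp ℝ 2 μ.fst}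
    (hv : WeakTendsto (fun m => (q' m).1) v) (hα : WeakTendsto (fun m => (q' m).2) α) {e : ℝ}
    (he : Tendsto (fun m => relaxedEnergy W γ lam μ μ' (q' m)) atTop (𝓝 e)) :
    relaxedEnergy W γ lam μ μ' (v, α) ≤ e := by
  have hone : WeakTendsto (fun m => (q' m).2 - Lp.const 2 μ.fst 1) (α - Lp.const 2 μ.fst 1) :=
    WeakTendsto.sub_const hα _
  have hkinetic := tendsto_min_of_forall_eventually_lt fun _ => hv.eventually_lt_norm
  have hweight := tendsto_min_of_forall_eventually_lt fun _ => hone.eventually_lt_norm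
  have hfidelity := tendsto_min_of_forall_eventually_lt fun _ =>
    WeakTendsto.eventually_lt_dualNorm_discrepancy (μ' := μ') hV hW hv hα
  have hlim := (((hkinetic.pow 2).const_mul (1 / 2)).add ((hweight.pow 2).const_mul (γ / 4))).add
    ((hfidelity.pow 2).const_mul (lam / 4))
  rw [relaxedEnergy_eq]
  refine le_of_tendsto_of_tendsto' hlim he fun m => ?_
  have hD (u : TimeL2 V) (β : Lp ℝ 2 μ.fst) : 0 ≤ dualNorm W (discrepancy μ μ' u β) :=
    dualNorm_discrepancy_nonneg u β
  rw [relaxedEnergy_eq]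
  gcongr
  · exact min_le_left _ _
  · exact min_le_left _ _
  · exact le_min (hD _ _) (hD _ _)
  · exact min_le_left _ _

theorem exists_isMinOn_relaxedEnergy [CompleteSpace V] (hV : IsC11Field (evalField V) c)
    (hW : IsBoundedEmbedding W C) (hγ : 0 < γ) (hlam : 0 ≤ lam) {A : Set (Lp ℝ 2 μ.fst)}
    (hA : A.Nonempty) (hconvex : Convex ℝ A) (hclosed : IsClosed A) :
    ∃ q : TimeL2 V × Lp ℝ 2 μ.fst, q.2 ∈ A ∧
      IsMinOn (relaxedEnergy W γ lam μ μ') {q' | q'.2 ∈ A} q := by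
  obtain ⟨α₀, hα₀⟩ := hA
  refine exists_isMinOn_of_forall_seq (S := {q : TimeL2 V × Lp ℝ 2 μ.fst | q.2 ∈ A})
    ⟨(0, α₀), hα₀⟩ ⟨0, ?_⟩ fun q' e hq' he => ?_
  · rintro _ ⟨q, -, rfl⟩
    exact relaxedEnergy_nonneg hγ.le hlam q
  obtain ⟨b, hb⟩ := he.bddAbove_range
  have hE (m : ℕ) : relaxedEnergy W γ lam μ μ' (q' m) ≤ b := hb (mem_range_self m)
  obtain ⟨v, θ, hθ, hv⟩ := exists_weakTendsto_subseq fun m =>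
    norm_fst_le_of_relaxedEnergy_le hγ.le hlam (hE m)
  have hα' (m : ℕ) : ‖(q' (θ m)).2‖ ≤ √(4 * b / γ) + ‖Lp.const 2 μ.fst (1 : ℝ)‖ :=
    (norm_le_norm_sub_add _ _).trans
      (by gcongr; exact norm_snd_sub_one_le_of_relaxedEnergy_le hγ hlam (hE (θ m)))
  obtain ⟨α, η, hη, hα⟩ := exists_weakTendsto_subseq hα'
  exact ⟨(v, α), hα.mem_of_convex_of_isClosed hconvex hclosed fun m => hq' _,
    relaxedEnergy_le_of_weakTendsto hV hW hγ.le hlam (hv.comp_strictMono hη) hα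
      (he.comp (hθ.comp hη).tendsto_atTop)⟩

end Energy

end VarifoldMetamorphosis

theorem mainTheorem4_general {n d : ℕ}
    {V : Type*} [NormedAddCommGroup V] [InnerProductSpace ℝ V] [CompleteSpace V]
    [RKHS ℝ V (Euc n) (Euc n)] {c : NNReal} (hV : IsC11Field (evalField V) c)
    {W : Type*} [NormedAddCommGroup W] [InnerProductSpace ℝ W]
    [RKHS ℝ W (Euc n × OrientedGrassmannian n d) ℝ] {C : ℝ} (hW : IsBoundedEmbedding W C)
    {γ lam : ℝ} (hγ : 0 < γ) (hlam : 0 ≤ lam)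
    (μ μ' : Measure (Euc n × OrientedGrassmannian n d)) [IsFiniteMeasure μ] [IsFiniteMeasure μ'] :
    (∀ v : TimeL2 V, IsFlow v (flow v) ∧
      ∀ ψ, IsFlow v ψ → ∀ t ∈ Set.Icc (0 : ℝ) 1, ψ t = flow v t) ∧
    ∀ A : Set (Lp ℝ 2 μ.fst), A.Nonempty → Convex ℝ A → IsClosed A →
      ∃ q : TimeL2 V × Lp ℝ 2 μ.fst, q.2 ∈ A ∧
        IsMinOn (relaxedEnergy W γ lam μ μ') {q' | q'.2 ∈ A} q :=
  ⟨fun v => ⟨isFlow_flow hV v, fun _ hψ _ ht => hψ.eq_flow hV ht⟩,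
    fun _ => exists_isMinOn_relaxedEnergy hV hW hγ hlam⟩

theorem mainTheorem4 (n d : ℕ) (hn : 2 ≤ n) (hd : d ≤ n)
    (V : Type*) [NormedAddCommGroup V] [InnerProductSpace ℝ V] [CompleteSpace V]
    [RKHS ℝ V (Euc n) (Euc n)] (hV : EmbedsInC02 n V)
    (k : Euc n × OrientedGrassmannian n d → Euc n × OrientedGrassmannian n d → ℝ)
    (W : Type*) [NormedAddCommGroup W] [InnerProductSpace ℝ W] [CompleteSpace W]
    [RKHS ℝ W (Euc n × OrientedGrassmannian n d) ℝ]
    (hk : IsC0Universal k W) (hW : EmbedsInC01 n d W)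
    (γ lam : ℝ) (hγ : 0 < γ) (hlam : 0 < lam)
    (μ μ' : Measure (Euc n × OrientedGrassmannian n d)) [IsFiniteMeasure μ] [IsFiniteMeasure μ']
    (K : Set (Euc n × OrientedGrassmannian n d)) (hK : IsCompact K) (hμK : μ.support ⊆ K) :
    -- every `v` has a unique flow, so that the functional is the intended one
    (∀ v : TimeL2 V, IsFlow v (flow v) ∧
      ∀ ψ, IsFlow v ψ → ∀ t ∈ Set.Icc (0 : ℝ) 1, ψ t = flow v t) ∧
    -- a minimizer over `L²([0,1], V) × L²(|μ|)`
    (∃ q : TimeL2 V × Lp ℝ 2 μ.fst,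
      IsMinOn (relaxedEnergy W γ lam μ μ') Set.univ q) ∧
    -- the same when the weights are constrained to be nonnegative
    (∃ q : TimeL2 V × Lp ℝ 2 μ.fst, 0 ≤ q.2 ∧
      IsMinOn (relaxedEnergy W γ lam μ μ') {q' | 0 ≤ q'.2} q) := by
  obtain ⟨c, hV⟩ := hV.exists_isC11Field
  obtain ⟨C, hW⟩ := hW.exists_isBoundedEmbedding
  obtain ⟨hflow, hmin⟩ := mainTheorem4_general hV hW hγ hlam.le μ μ'
  exact ⟨hflow, (hmin univ univ_nonempty convex_univ isClosed_univ).imp fun _ hq => hq.2,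
    hmin (Ici 0) nonempty_Ici convex_Ici_zero_Lp isClosed_Ici⟩
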